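/- Let $f_1:\mathbb{R}^{d_x}\to\mathbb{R}$ be $\mu_x$-strongly convex and $L_x$-smooth with $L_x\ge\mu_x>0$, let $g_1:\mathbb{R}^{d_y}\to\mathbb{R}$ be convex and $L_y$-smooth with $L_y\ge 0$, let $f_2:\mathbb{R}^{d_x}\to\mathbb{R}\cup\{+\infty\}$ and $g_2:\mathbb{R}^{d_y}\to\mathbb{R}\cup\{+\infty\}$ be proper, convex and lower semicontinuous, and let $B\in\mathbb{R}^{d_y\times d_x}$ be nonzero with largest singular value $\sigma$. Let $(x^*,y^*)$ be a saddle point of $f_1(x)+f_2(x)+y^\top Bx-g_1(y)-g_2(y)$ (minimized in $x$, maximized in $y$). Put $\varphi(y)=g_1(y)+(f_1+f_2)^*(-B^\top y)$, where $^*$ denotes the Fenchel conjugate, and $\Phi=\varphi+g_2$, and suppose that $\varphi$ is $\mu_\varphi$-strongly convex with $\mu_\varphi>0$. Let $$L_\varphi=L_y+\frac{\sigma^2}{\mu_x},\quad \kappa_\varphi=\frac{L_\varphi}{\mu_\varphi}=\frac{\sigma^2+\mu_xL_y}{\mu_x\mu_\varphi},\quad \kappa_x=\frac{L_x}{\mu_x},\quad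 \beta=\frac{\sqrt{\kappa_\varphi}-1}{\sqrt{\kappa_\varphi}+1},\quad x^*(z)=\arg\min_x f_1(x)+f_2(x)+\langle B^\top z,x\rangle .$$ iDAPG started at $x^0\in\mathbb{R}^{d_x}$ and $z^0=y^0\in\operatorname{dom}g_2$ computes, for $k=0,1,2,\dots$, an approximation $x^{k+1}$ of $x^*(z^k)$ and then $$y^{k+1}=\operatorname{prox}_{g_2/L_\varphi}\Big(z^k-\tfrac1{L_\varphi}\big(\nabla g_1(z^k)-Bx^{k+1}\big)\Big),\qquad z^{k+1}=y^{k+1}+\beta(y^{k+1}-y^k).$$ Fix $c>1$, let $\Delta=\Phi(y^0)-\Phi(y^*)$ and $$\theta=1-\frac1{c\sqrt{\kappa_\varphi}},\qquad \varepsilon_1=\Big(\sqrt\theta-\sqrt{1-1/\sqrt{\kappa_\varphi}}\Big)\sqrt{\mu_\varphi\Delta},\qquad \varepsilon_{k+1}^2=\theta\,\varepsilon_k^2\ (k\ge1),$$ and require $\|x^{k+1}-x^*(z^k)\|^2\le\varepsilon_{k+1}^2/\sigma^2$ for all $k\ge 0$. Let $$\mathcal C=\frac{32\sigma^2\kappa_\varphi\big(2+\sqrt{1-1/\sqrt{\kappa_\varphi}}\big)^2}{\mu_x^2\mu_\varphi(\sqrt{\kappa_\varphi}+1)^2}+\frac{2\mu_\varphi}{\sigma^2}\Big(\sqrt\theta-\sqrt{1-1/\sqrt{\kappa_\varphi}}\Big)^2>0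 .$$ There is a constant $A>0$ that depends only on $c$ such that, for all data as above, the following holds. (1) Outer iterations. For every $\epsilon>0$ and every integer $k\ge 0$ with $k\ge A\sqrt{\kappa_\varphi}\,\log(\mathcal C\Delta/\epsilon)$ (where, if $\Delta=0$, every $k\ge0$ is allowed), we have $\|x^{k+1}-x^*\|^2\le\epsilon$ and $\|y^k-y^*\|^2\le\frac{\mu_x^2}{\sigma^2}\epsilon$. That is, the outer iteration complexity is $O\big(\sqrt{\kappa_\varphi}\log(\mathcal C\Delta/\epsilon)\big)$. (2) Inner iterations. Let $\Delta>0$, and let the $k$-th subproblem $\min_x f_1(x)+f_2(x)+\langle B^\top z^k,x\rangle$ be solved by the accelerated proximal gradient method (APG) started at $w_0=u_0=x^k$, $$w_{n+1}=\operatorname{prox}_{f_2/L_x}\Big(u_n-\tfrac1{L_x}\big(\nabla f_1(u_n)+B^\top z^k\big)\Big),\qquad u_{n+1}=w_{n+1}+\frac{t_n(1-t_n)}{t_n^2+t_{n+1}}(w_{n+1}-w_n),$$ where $t_0=1$ and $t_{n+1}>0$ solves $t_{n+1}^2=(1-t_{n+1})t_n^2+\frac{\mu_x}{L_x}t_{n+1}$,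 and let $x^{k+1}=w_{N_k}$ with $N_k$ the first $n\ge0$ for which $\|w_n-x^*(z^k)\|^2\le\varepsilon_{k+1}^2/\sigma^2$. Then every $N_k$ is finite, and for every $\epsilon>0$ there is a $K$ such that the two accuracy bounds of (1) hold for all $k\ge K$ and the total number $\sum_{k=0}^{K}N_k$ of inner iterations is at most $$A\sqrt{\kappa_x}\Big[\big(1+\log(\kappa_\varphi\kappa_x)\big)\Big(\sqrt{\kappa_\varphi}\max\big\{\log\tfrac{\mathcal C\Delta}{\epsilon},0\big\}+1\Big)+\log\Big(1+\frac{\kappa_x\sigma^2\|x^0-x^*(y^0)\|^2}{\varepsilon_1^2}\Big)\Big].$$ Moreover there is an $\epsilon_0>0$ (depending on the problem and on the starting point) such that for every $0<\epsilon<\epsilon_0$ there is a $K$ such that the two accuracy bounds of (1) hold for all $k\ge K$ and $$\sum_{k=0}^{K}N_k\le A\big(1+\log(\kappa_\varphi\kappa_x)\big)\sqrt{\kappa_\varphi\kappa_x}\,\log\frac{\mathcal C\Delta}{\epsilon}.$$ That is, the inner iteration complexity is $\tilde O\big(\sqrt{\kappa_\varphi\kappa_x}\log(\mathcal C\Delta/\epsilon)\big)$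 as $\epsilon\to0$, where $\tilde O$ hides only a logarithmic factor in the problem parameters. -/

import Mathlib

noncomputable section

namespace IDAPG

/-- The Euclidean space `ℝᵈ`. -/
abbrev E (d : ℕ) := EuclideanSpace ℝ (Fin d)

/-! ### Convex-analysis notions -/

section Notions
variable {d : ℕ}

/-- `f : ℝᵈ → ℝ` is `L`-smooth: differentiable with `L`-Lipschitz gradient. -/
def IsSmooth (L : ℝ) (f : E d → ℝ) : Prop :=
  Differentiable ℝ f ∧ ∀ u v, ‖gradient f u - gradient f v‖ ≤ L * ‖u - v‖

/-- Proper, convex (convex epigraph), lower semicontinuous extended-real-valued functions. -/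
structure IsProperConvexLSC (f : E d → EReal) : Prop where
  ne_bot : ∀ u, f u ≠ ⊥
  exists_ne_top : ∃ u, f u ≠ ⊤
  convex : Convex ℝ {p : E d × ℝ | f p.1 ≤ (p.2 : EReal)}
  lsc : LowerSemicontinuous f

/-- Fenchel conjugate `f*(s) = sup_u ⟨s, u⟩ - f u`. -/
def conjugate (f : E d → EReal) (s : E d) : EReal :=
  ⨆ u, ((inner ℝ s u : ℝ) : EReal) - f u

/-- A global minimizer of `F`. It is used only for functions that are proper, lower semicontinuous
and strongly convex, for which a minimizer exists and is unique. -/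
def argmin (F : E d → EReal) : E d :=
  Classical.epsilon fun u => IsMinOn F Set.univ u

/-- `prox_{α f}(v) = argmin_u f u + ‖u - v‖² / (2 α)`. -/
def prox (α : ℝ) (f : E d → EReal) (v : E d) : E d :=
  argmin fun u => f u + ((1 / (2 * α) * ‖u - v‖ ^ 2 : ℝ) : EReal)

/-- The parameters of the accelerated proximal gradient method (APG) with step size `1 / L`, where
`q = μ / L`: `t₀ = 1`, and `tₙ₊₁` is the positive root `t` of `t² = (1 - t) tₙ² + q t`. -/
def apgParam (q : ℝ) : ℕ → ℝ
  | 0 => 1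
  | n + 1 => (q - apgParam q n ^ 2 +
      √((q - apgParam q n ^ 2) ^ 2 + 4 * apgParam q n ^ 2)) / 2

/-- APG for `min g + h` with `g` being `μ`-strongly convex and `L`-smooth, `G = ∇g`, started at `w`.
The `n`-th value is the pair `(wₙ, uₙ)` of the `n`-th iterate and the `n`-th extrapolated point:
`w₀ = u₀ = w`, `wₙ₊₁ = prox_{h/L}(uₙ - G(uₙ)/L)`, and
`uₙ₊₁ = wₙ₊₁ + bₙ (wₙ₊₁ - wₙ)` with `bₙ = tₙ (1 - tₙ) / (tₙ² + tₙ₊₁)`. -/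
def apg (G : E d → E d) (h : E d → EReal) (μ L : ℝ) (w : E d) : ℕ → E d × E d
  | 0 => (w, w)
  | n + 1 =>
    let s := apg G h μ L w n
    let w' := prox (1 / L) h (s.2 - (1 / L) • G s.2)
    let t := apgParam (μ / L) n
    let t' := apgParam (μ / L) (n + 1)
    (w', w' + (t * (1 - t) / (t ^ 2 + t')) • (w' - s.1))

end Notions

/-! ### The minimax problem -/

/-- The data of `min_x max_y f₁(x) + f₂(x) + ⟨y, B x⟩ - g₁(y) - g₂(y)` with its parameters. -/
structure Problem (dx dy : ℕ) where
  f₁ : E dx → ℝ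
  f₂ : E dx → EReal
  g₁ : E dy → ℝ
  g₂ : E dy → EReal
  B : E dx →L[ℝ] E dy
  μx : ℝ
  Lx : ℝ
  Ly : ℝ
  μφ : ℝ

namespace Problem
variable {dx dy : ℕ} (P : Problem dx dy)

/-- The largest singular value of `B` is its operator norm. -/
def σ : ℝ := ‖P.B‖

/-- The transpose of `B`. -/
def Bt : E dy →L[ℝ] E dx := ContinuousLinearMap.adjoint P.B

/-- The saddle function. (The undetermined case `f₂ x = g₂ y = ⊤` never enters below.) -/
def lagr (x : E dx) (y : E dy) : EReal :=
  ((P.f₁ x + inner ℝ y (P.B x) - P.g₁ y : ℝ) : EReal) + P.f₂ x - P.g₂ y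

/-- `(xs, ys)` is a solution, that is, a saddle point. -/
structure IsSaddle (xs : E dx) (ys : E dy) : Prop where
  x_dom : P.f₂ xs ≠ ⊤
  y_dom : P.g₂ ys ≠ ⊤
  max_y : ∀ y, P.lagr xs y ≤ P.lagr xs ys
  min_x : ∀ x, P.lagr xs ys ≤ P.lagr x ys

/-- `φ(y) = g₁(y) + (f₁ + f₂)*(-Bᵀ y)`. -/
def φ (y : E dy) : EReal :=
  (P.g₁ y : EReal) + conjugate (fun x => (P.f₁ x : EReal) + P.f₂ x) (-(P.Bt y))

/-- `Φ = φ + g₂`. -/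
def Φ (y : E dy) : EReal := P.φ y + P.g₂ y

/-- Objective of the subproblem in `x` at the dual point `z`: `f₁(x) + f₂(x) + ⟨Bᵀ z, x⟩`. -/
def subObj (z : E dy) (x : E dx) : EReal :=
  ((P.f₁ x + inner ℝ (P.Bt z) x : ℝ) : EReal) + P.f₂ x

/-- The exact solution `x*(z)` of the subproblem at `z`. -/
def xStar (z : E dy) : E dx := argmin (P.subObj z)

/-- Standing assumptions, including strong convexity of `φ` (which is finite everywhere because
`f₁ + f₂` is proper, lower semicontinuous and strongly convex, so that `toReal` loses nothing). -/
structure Assumptions : Prop where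
  μx_pos : 0 < P.μx
  μx_le_Lx : P.μx ≤ P.Lx
  f₁_strong : StrongConvexOn Set.univ P.μx P.f₁
  f₁_smooth : IsSmooth P.Lx P.f₁
  Ly_nonneg : 0 ≤ P.Ly
  g₁_convex : ConvexOn ℝ Set.univ P.g₁
  g₁_smooth : IsSmooth P.Ly P.g₁
  f₂_pcl : IsProperConvexLSC P.f₂
  g₂_pcl : IsProperConvexLSC P.g₂
  B_ne_zero : P.B ≠ 0
  μφ_pos : 0 < P.μφ
  φ_strong : StrongConvexOn Set.univ P.μφ fun y => (P.φ y).toReal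

/-- `κ_x = L_x / μ_x`. -/
def κx : ℝ := P.Lx / P.μx

/-- `L_φ = L_y + σ² / μ_x`. -/
def Lφ : ℝ := P.Ly + P.σ ^ 2 / P.μx

/-- `κ_φ = (σ² + μ_x L_y) / (μ_x μ_φ)`, which is `L_φ / μ_φ`. -/
def κφ : ℝ := (P.σ ^ 2 + P.μx * P.Ly) / (P.μx * P.μφ)

/-- The extrapolation parameter of the outer method. -/
def β : ℝ := (√P.κφ - 1) / (√P.κφ + 1)

/-- `θ = 1 - 1 / (c √κ_φ)`. -/
def θ (c : ℝ) : ℝ := 1 - 1 / (c * √P.κφ)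

/-- `Φ(y⁰) - Φ(y*)`, where `y⁰` and `y*` lie in the domain of `g₂`. -/
def gap (y0 ys : E dy) : ℝ := (P.Φ y0 - P.Φ ys).toReal

/-- `ε₁ = (√θ - √(1 - 1/√κ_φ)) √(μ_φ (Φ(y⁰) - Φ(y*)))`. -/
def ε₁ (c : ℝ) (y0 ys : E dy) : ℝ :=
  (√(P.θ c) - √(1 - 1 / √P.κφ)) * √(P.μφ * P.gap y0 ys)

/-- `ε²_{k+1}`, from `ε²_{k+1} = θ ε²_k` for `k ≥ 1`. -/
def εSq (c : ℝ) (y0 ys : E dy) (k : ℕ) : ℝ := P.θ c ^ k * P.ε₁ c y0 ys ^ 2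

/-- The constant inside the logarithm of the complexity bounds. -/
def C (c : ℝ) : ℝ :=
  32 * P.σ ^ 2 * P.κφ * (2 + √(1 - 1 / √P.κφ)) ^ 2 / (P.μx ^ 2 * P.μφ * (√P.κφ + 1) ^ 2)
    + 2 * P.μφ / P.σ ^ 2 * (√(P.θ c) - √(1 - 1 / √P.κφ)) ^ 2

/-! ### The method -/

/-- The update of `y` from the extrapolated point `z` and the new primal point `x'`. -/
def yStep (z : E dy) (x' : E dx) : E dy :=
  prox (1 / P.Lφ) P.g₂ (z - (1 / P.Lφ) • (gradient P.g₁ z - P.B x'))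

/-- `x, y, z` are iterates of iDAPG; how `x (k + 1)` is obtained is left open here. -/
structure IsIDAPG (x : ℕ → E dx) (y z : ℕ → E dy) : Prop where
  z_zero : z 0 = y 0
  y_succ : ∀ k, y (k + 1) = P.yStep (z k) (x (k + 1))
  z_succ : ∀ k, z (k + 1) = y (k + 1) + P.β • (y (k + 1) - y k)

/-- `x'` solves the `k`-th subproblem, posed at `z`, to the accuracy
`‖x' - x*(z)‖² ≤ ε²_{k+1} / σ²`. -/
def Accurate (c : ℝ) (y0 ys : E dy) (k : ℕ) (z : E dy) (x' : E dx) : Prop :=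
  ‖x' - P.xStar z‖ ^ 2 ≤ P.εSq c y0 ys k / P.σ ^ 2

/-- The `n`-th iterate of APG applied to the subproblem at `z`, started at `w`. -/
def subApg (z : E dy) (w : E dx) (n : ℕ) : E dx :=
  (apg (fun u => gradient P.f₁ u + P.Bt z) P.f₂ P.μx P.Lx w n).1

/-- The number of APG iterations that the `k`-th subproblem, posed at `z` and warm-started at `w`,
takes until the required accuracy is reached for the first time. -/
def innerCount (c : ℝ) (y0 ys : E dy) (k : ℕ) (z : E dy) (w : E dx) : ℕ :=
  sInf {n : ℕ | P.Accurate c y0 ys k z (P.subApg z w n)}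

/-- The states `(xᵏ, yᵏ, zᵏ)` of iDAPG started at `(x0, y0)`, where the `k`-th subproblem is solved
by APG, warm-started at `xᵏ` and stopped as soon as the required accuracy is reached. -/
def run (c : ℝ) (ys : E dy) (x0 : E dx) (y0 : E dy) : ℕ → E dx × E dy × E dy
  | 0 => (x0, y0, y0)
  | k + 1 =>
    let s := run c ys x0 y0 k
    let x' := P.subApg s.2.2 s.1 (P.innerCount c y0 ys k s.2.2 s.1)
    let y' := P.yStep s.2.2 x'
    (x', y', y' + P.β • (y' - s.2.1))

/-- The primal iterates of `run`. -/
def runX (c : ℝ) (ys : E dy) (x0 : E dx) (y0 : E dy) (k : ℕ) : E dx := (P.run c ys x0 y0 k).1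

/-- The dual iterates of `run`. -/
def runY (c : ℝ) (ys : E dy) (x0 : E dx) (y0 : E dy) (k : ℕ) : E dy := (P.run c ys x0 y0 k).2.1

/-- The extrapolated dual points of `run`. -/
def runZ (c : ℝ) (ys : E dy) (x0 : E dx) (y0 : E dy) (k : ℕ) : E dy := (P.run c ys x0 y0 k).2.2

/-- The total number of inner (APG) iterations spent by `run` on the subproblems `0, …, K`,
that is, in order to compute `x^{K+1}`. -/
def totalInner (c : ℝ) (ys : E dy) (x0 : E dx) (y0 : E dy) (K : ℕ) : ℕ :=
  ∑ k ∈ Finset.range (K + 1),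
    P.innerCount c y0 ys k (P.runZ c ys x0 y0 k) (P.runX c ys x0 y0 k)

/-- `ε`-accuracy at the `k`-th outer iteration:
`‖x^{k+1} - x*‖² ≤ ε` and `‖yᵏ - y*‖² ≤ (μ_x² / σ²) ε`. -/
def Reached (xs : E dx) (ys : E dy) (ε : ℝ) (x : ℕ → E dx) (y : ℕ → E dy) (k : ℕ) : Prop :=
  ‖x (k + 1) - xs‖ ^ 2 ≤ ε ∧ ‖y k - ys‖ ^ 2 ≤ P.μx ^ 2 / P.σ ^ 2 * ε

end Problem

end IDAPG

end

/-!
The dual objective `φ` has the subgradient `∇g₁(z) - B x*(z)` at `z`. Minimality of `x*(z)` alone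
gives a quadratic upper bound for `φ` with constant `L_φ = L_y + σ² / μ_x` (`φ_upper`), and the
assumed strong convexity turns the subgradient inequality into a quadratic lower bound with constant
`μ_φ` (`φ_lower`). Hence iDAPG is an accelerated proximal gradient method for `Φ = φ + g₂` whose
gradients carry the errors `eₖ = B (x*(zᵏ) - xᵏ⁺¹)`, and the accuracy condition bounds `‖eₖ‖` by
`ε_{k+1}`. Differentiability of conjugates is never needed.

Both methods rest on one inequality, `lyapunov_step`: the optimality gap at the current iterate plus
a multiple of the squared distance from an auxiliary point `v` to the solution contracts by `1 - t`,
up to the term `t ⟨e, s - v'⟩`. For the outer method `t = 1 / √κ_φ`. The Lyapunov value `V'` itself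
controls `‖s - v'‖`, so the error enters `√V` additively, and the tolerances `ε_{k+1}` are chosen
such that `Vₖ ≤ 2 Δ θᵏ` is preserved (`lyapunov_rate_step`, `outer_rate`). Quadratic growth of `Φ`
around `y*` and Lipschitz continuity of `x*` then give accuracy `𝒞 Δ θᵏ` (`reached_of_le`), and
`θ ≤ exp (-1 / (c √κ_φ))` gives the outer complexity.

For APG the parameters `tₙ` stay in `[√(μ_x / L_x), 1]`, and the first step is a plain proximal
gradient step, so that the squared distance to the subproblem solution is at most
`(1 - 1/√κ_x)ⁿ (κ_x - 1)` times the initial one after `n + 1` steps (`apg_norm_sq_le`). Consecutive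
extrapolated points are `O(√(Δ θᵏ / μ_φ))` apart, hence with a warm start the initial squared error
of a subproblem exceeds the tolerance only by a factor `O(κ_φ³)` (`warm_start`), and each subproblem
but the first takes `O(√κ_x (1 + log (κ_φ κ_x)))` steps. Summation over the outer iterations
(`totalInner_le`) gives the inner complexity.
-/

namespace IDAPG

open Filter Topology

section ConvexAnalysis
variable {d : ℕ}

/-! ### Strongly convex extended-real-valued functions -/

/-- `m`-strong convexity of an extended-real-valued function, expressed through real upper bounds
on its values so that no arithmetic in `EReal` is involved. -/
def IsStronglyConvex (m : ℝ) (F : E d → EReal) : Prop :=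
  ∀ (u v : E d) (a b t : ℝ), F u ≤ a → F v ≤ b → 0 ≤ t → t ≤ 1 →
    F ((1 - t) • u + t • v) ≤
      (((1 - t) * a + t * b - m / 2 * (t * (1 - t)) * ‖u - v‖ ^ 2 : ℝ) : EReal)

lemma IsProperConvexLSC.coe_toReal {f : E d → EReal} (hf : IsProperConvexLSC f) {u : E d}
    (hu : f u ≠ ⊤) : ((f u).toReal : EReal) = f u :=
  EReal.coe_toReal hu (hf.ne_bot u)

lemma add_le_coe_iff {f : EReal} (hbot : f ≠ ⊥) (h a : ℝ) :
    (h : EReal) + f ≤ a ↔ f ≤ ((a - h : ℝ) : EReal) := by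
  induction f with
  | bot => exact absurd rfl hbot
  | top =>
    rw [EReal.coe_add_top]
    exact iff_of_false (not_le.2 (EReal.coe_lt_top _)) (not_le.2 (EReal.coe_lt_top _))
  | coe r => norm_cast; constructor <;> intro H <;> linarith

lemma isStronglyConvex_add {m : ℝ} {h : E d → ℝ} {f : E d → EReal}
    (hh : StrongConvexOn Set.univ m h) (hf : IsProperConvexLSC f) :
    IsStronglyConvex m fun u => (h u : EReal) + f u := by
  intro u v a b t hu hv ht0 ht1
  rw [add_le_coe_iff (hf.ne_bot _)] at hu hv ⊢
  have h1 : f ((1 - t) • u + t • v) ≤ (((1 - t) * (a - h u) + t * (b - h v) : ℝ) : EReal) :=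
    hf.convex (x := (u, a - h u)) hu (y := (v, b - h v)) hv
      (by linarith : (0 : ℝ) ≤ 1 - t) ht0 (by ring)
  have h2 := hh.2 (Set.mem_univ u) (Set.mem_univ v) (by linarith : (0 : ℝ) ≤ 1 - t) ht0 (by ring)
  refine h1.trans (EReal.coe_le_coe_iff.2 ?_)
  simp only [smul_eq_mul] at h2
  nlinarith [h2]

lemma lowerSemicontinuous_add {h : E d → ℝ} {f : E d → EReal}
    (hh : Continuous h) (hf : IsProperConvexLSC f) :
    LowerSemicontinuous fun u => (h u : EReal) + f u := by
  refine LowerSemicontinuous.add' (continuous_coe_real_ereal.comp hh).lowerSemicontinuous hf.lsc ?_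
  intro x
  exact EReal.continuousAt_add (Or.inl (EReal.coe_ne_top _)) (Or.inl (EReal.coe_ne_bot _))

/-- Coercivity comes from comparing `F u` with the value of `F` at distance one from a point `u₀` of
the domain, where `F` is bounded below by lower semicontinuity and compactness. -/
lemma IsStronglyConvex.exists_isMinOn {m : ℝ} (hm : 0 < m) {F : E d → EReal}
    (hF : IsStronglyConvex m F) (hbot : ∀ u, F u ≠ ⊥) (hlsc : LowerSemicontinuous F)
    {u₀ : E d} (hu₀ : F u₀ ≠ ⊤) : ∃ p, IsMinOn F Set.univ p := by
  obtain ⟨a, ha⟩ : ∃ a : ℝ, F u₀ = a := ⟨_, (EReal.coe_toReal hu₀ (hbot _)).symm⟩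
  obtain ⟨q, -, hq⟩ := LowerSemicontinuousOn.exists_isMinOn
    (Metric.nonempty_closedBall.2 (zero_le_one (α := ℝ)))
    (isCompact_closedBall u₀ 1) (hlsc.lowerSemicontinuousOn _)
  obtain ⟨b, hb⟩ : ∃ b : ℝ, (b : EReal) ≤ F q := by
    induction h : F q with
    | bot => exact absurd h (hbot q)
    | top => exact ⟨0, le_top⟩
    | coe r => exact ⟨r, le_rfl⟩
  have hball : ∀ u, ‖u - u₀‖ ≤ 1 → (b : EReal) ≤ F u := fun u hu =>
    hb.trans (hq (by simpa [dist_eq_norm] using hu))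
  set R : ℝ := max 1 (1 + 2 / m * (a - b)) with hR
  have hR1 : 1 ≤ R := le_max_left _ _
  obtain ⟨p, hp, hpmin⟩ := LowerSemicontinuousOn.exists_isMinOn
    (Metric.nonempty_closedBall.2 (zero_le_one.trans hR1))
    (isCompact_closedBall u₀ R) (hlsc.lowerSemicontinuousOn _)
  refine ⟨p, fun u _ => ?_⟩
  change F p ≤ F u
  by_cases hu : ‖u - u₀‖ ≤ R
  · exact hpmin (by simpa [dist_eq_norm] using hu)
  refine (hpmin (Metric.mem_closedBall_self (zero_le_one.trans hR1)) : F p ≤ F u₀).trans ?_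
  by_contra! hlt
  rw [ha] at hlt
  obtain ⟨r, hr, hra⟩ : ∃ r : ℝ, F u = r ∧ r < a := by
    have hne : F u ≠ ⊤ := (hlt.trans (EReal.coe_lt_top a)).ne
    refine ⟨_, (EReal.coe_toReal hne (hbot u)).symm, ?_⟩
    rw [← EReal.coe_lt_coe_iff, EReal.coe_toReal hne (hbot u)]
    exact hlt
  push Not at hu
  set ρ := ‖u - u₀‖ with hρ
  have hρ1 : 1 < ρ := hR1.trans_lt hu
  have hρ0 : 0 < ρ := by linarith
  have h1 := hF u₀ u a r (1 / ρ) ha.le hr.le (by positivity)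
    ((div_le_one hρ0).2 hρ1.le)
  have h2 := hball ((1 - 1 / ρ) • u₀ + (1 / ρ) • u) (by
    have : (1 - 1 / ρ) • u₀ + (1 / ρ) • u - u₀ = (1 / ρ) • (u - u₀) := by module
    rw [this, norm_smul, ← hρ, Real.norm_eq_abs, abs_of_pos (by positivity)]
    field_simp
    rfl)
  have h3 := EReal.coe_le_coe_iff.1 (h2.trans h1)
  rw [norm_sub_rev, ← hρ] at h3
  have h4 : m / 2 * (1 / ρ * (1 - 1 / ρ)) * ρ ^ 2 = m / 2 * (ρ - 1) := by
    field_simp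
  have h5 : 1 + 2 / m * (a - b) < ρ := (le_max_right _ _).trans_lt hu
  have h6 : a - b < m / 2 * (ρ - 1) := by
    have : m / 2 * (1 + 2 / m * (a - b)) < m / 2 * ρ := by gcongr
    have h7 : m / 2 * (1 + 2 / m * (a - b)) = m / 2 + (a - b) := by field_simp
    linarith
  have h8 : 1 / ρ * r ≤ 1 / ρ * a := by gcongr
  nlinarith

/-- Passing to the limit `t → 0` in the usual strong convexity estimates. -/
lemma add_le_of_forall_add_one_sub_mul_le {x y k : ℝ}
    (h : ∀ t : ℝ, 0 < t → t ≤ 1 → x + (1 - t) * k ≤ y) : x + k ≤ y := by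
  have h1 : Tendsto (fun t : ℝ => x + (1 - t) * k) (𝓝[>] 0) (𝓝 (x + (1 - 0) * k)) := by
    refine Tendsto.mono_left (Continuous.tendsto (by fun_prop) _) nhdsWithin_le_nhds
  have h2 : x + (1 - 0) * k ≤ y := by
    refine le_of_tendsto h1 ?_
    filter_upwards [Ioc_mem_nhdsGT (zero_lt_one (α := ℝ))] with t ht using h t ht.1 ht.2
  simpa using h2

lemma IsStronglyConvex.growth {m : ℝ} {F : E d → EReal}
    (hF : IsStronglyConvex m F) {p u : E d} {a b : ℝ} (hp : IsMinOn F Set.univ p)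
    (ha : F p = a) (hb : F u = b) : a + m / 2 * ‖u - p‖ ^ 2 ≤ b := by
  refine add_le_of_forall_add_one_sub_mul_le fun t ht0 ht1 => ?_
  have h1 := hF p u a b t ha.le hb.le ht0.le ht1
  have h2 : F p ≤ F ((1 - t) • p + t • u) := hp (Set.mem_univ _)
  rw [ha] at h2
  have h3 := EReal.coe_le_coe_iff.1 (h2.trans h1)
  rw [norm_sub_rev p u] at h3
  have h4 : t * (a + (1 - t) * (m / 2 * ‖u - p‖ ^ 2)) ≤ t * b := by nlinarith
  exact le_of_mul_le_mul_left h4 ht0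

/-- The minimizer of the sum of a strongly convex function and a proper convex lower semicontinuous
function exists, lies in the domain, and is unique by quadratic growth. -/
lemma argmin_spec {m : ℝ} (hm : 0 < m) {h : E d → ℝ} {f : E d → EReal}
    (hh : StrongConvexOn Set.univ m h) (hc : Continuous h) (hf : IsProperConvexLSC f)
    {F : E d → EReal} (hF : ∀ u, F u = (h u : EReal) + f u) :
    f (argmin F) ≠ ⊤ ∧ ∀ u, f u ≠ ⊤ →
      h (argmin F) + (f (argmin F)).toReal + m / 2 * ‖u - argmin F‖ ^ 2 ≤ h u + (f u).toReal := by
  obtain rfl : F = fun u => (h u : EReal) + f u := funext hF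
  obtain ⟨u₀, hu₀⟩ := hf.exists_ne_top
  have hsc := isStronglyConvex_add hh hf
  have hbot : ∀ u, (h u : EReal) + f u ≠ ⊥ := fun u => by
    simp [EReal.add_eq_bot_iff, hf.ne_bot u]
  have hval : ∀ u, f u ≠ ⊤ → (h u : EReal) + f u = ((h u + (f u).toReal : ℝ) : EReal) := by
    intro u hu
    rw [EReal.coe_add, hf.coe_toReal hu]
  have hmin : IsMinOn (fun u => (h u : EReal) + f u) Set.univ
      (argmin fun u => (h u : EReal) + f u) := by
    refine Classical.epsilon_spec (p := fun u => IsMinOn _ Set.univ u) ?_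
    refine hsc.exists_isMinOn hm hbot (lowerSemicontinuous_add hc hf) (u₀ := u₀) ?_
    rw [hval u₀ hu₀]; exact EReal.coe_ne_top _
  have htop : f (argmin fun u => (h u : EReal) + f u) ≠ ⊤ := by
    intro H
    have := hmin (Set.mem_univ u₀)
    simp only [Set.mem_ofPred_eq, H, hval u₀ hu₀] at this
    simp at this
    exact EReal.coe_ne_top (h u₀ + (f u₀).toReal) (by exact_mod_cast this)
  exact ⟨htop, fun u hu => hsc.growth hmin (hval _ htop) (hval u hu)⟩

/-- The identity `‖(1 - t) u + t v‖² = (1 - t) ‖u‖² + t ‖v‖² - t (1 - t) ‖u - v‖²`. -/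
lemma norm_sq_convex_comb (u v : E d) (t : ℝ) :
    ‖(1 - t) • u + t • v‖ ^ 2 =
      (1 - t) * ‖u‖ ^ 2 + t * ‖v‖ ^ 2 - t * (1 - t) * ‖u - v‖ ^ 2 := by
  rw [norm_add_sq_real, norm_sub_sq_real, norm_smul, norm_smul, inner_smul_left, inner_smul_right]
  simp only [mul_pow, Real.norm_eq_abs, sq_abs, conj_trivial]
  ring

lemma strongConvexOn_norm_sub_sq (L : ℝ) (z : E d) :
    StrongConvexOn Set.univ L fun u => L / 2 * ‖u - z‖ ^ 2 := by
  refine ⟨convex_univ, fun u _ v _ a b _ _ hab => ?_⟩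
  obtain rfl : a = 1 - b := by linarith
  have h1 : (1 - b) • u + b • v - z = (1 - b) • (u - z) + b • (v - z) := by module
  have h2 : u - z - (v - z) = u - v := by abel
  simp only [smul_eq_mul]
  rw [h1, norm_sq_convex_comb, h2]
  apply le_of_eq
  ring

/-- The proximal step is characterized by `(v - p) / α ∈ ∂f(p)` for `p = prox_{α f}(v)`; here
`α = 1 / L`. -/
lemma prox_spec {L : ℝ} (hL : 0 < L) {f : E d → EReal} (hf : IsProperConvexLSC f) (v : E d) :
    f (prox (1 / L) f v) ≠ ⊤ ∧ ∀ u, f u ≠ ⊤ →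
      (f (prox (1 / L) f v)).toReal + L * inner ℝ (v - prox (1 / L) f v) (u - prox (1 / L) f v)
        ≤ (f u).toReal := by
  have hLe : 1 / (2 * (1 / L)) = L / 2 := by field_simp
  obtain ⟨h1, h2⟩ := argmin_spec hL (strongConvexOn_norm_sub_sq L v) (by fun_prop) hf
    (F := fun u => f u + ((1 / (2 * (1 / L)) * ‖u - v‖ ^ 2 : ℝ) : EReal))
    (fun u => by rw [add_comm, hLe])
  change f (prox (1 / L) f v) ≠ ⊤ at h1
  refine ⟨h1, fun u hu => ?_⟩
  have h3 := h2 u hu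
  change L / 2 * ‖prox (1 / L) f v - v‖ ^ 2 + (f (prox (1 / L) f v)).toReal
    + L / 2 * ‖u - prox (1 / L) f v‖ ^ 2 ≤ _ at h3
  set p := prox (1 / L) f v
  have h4 : u - v = (u - p) - (v - p) := by abel
  rw [h4, norm_sub_rev p v, norm_sub_sq_real (u - p), real_inner_comm] at h3
  linarith

/-! ### Smooth and convex functions -/

lemma IsSmooth.hasDerivAt_line {L : ℝ} {f : E d → ℝ} (hf : IsSmooth L f) (u v : E d) (t : ℝ) :
    HasDerivAt (fun s : ℝ => f (u + s • v)) (inner ℝ (gradient f (u + t • v)) v) t := by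
  have h1 := (hf.1 (u + t • v)).hasGradientAt.hasFDerivAt
  have h2 : HasDerivAt (fun s : ℝ => u + s • v) ((1 : ℝ) • v) t :=
    ((hasDerivAt_id t).smul_const v).const_add u
  have h3 := h1.comp_hasDerivAt t h2
  simpa [InnerProductSpace.toDual_apply_apply, Function.comp_def] using h3

/-- The descent lemma for functions with Lipschitz gradient. -/
lemma IsSmooth.le_quadratic {L : ℝ} {f : E d → ℝ} (hf : IsSmooth L f) (u v : E d) :
    f v ≤ f u + inner ℝ (gradient f u) (v - u) + L / 2 * ‖v - u‖ ^ 2 := by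
  set w := v - u with hw
  have hd := hf.hasDerivAt_line u w
  have hB : ∀ t : ℝ, HasDerivAt
      (fun s : ℝ => f u + s * inner ℝ (gradient f u) w + L / 2 * s ^ 2 * ‖w‖ ^ 2)
      (inner ℝ (gradient f u) w + L * t * ‖w‖ ^ 2) t := by
    intro t
    have h1 := ((hasDerivAt_id t).mul_const (inner ℝ (gradient f u) w)).const_add (f u)
    have h2 := (((hasDerivAt_pow 2 t).const_mul (L / 2)).mul_const (‖w‖ ^ 2))
    refine (h1.add h2).congr_deriv ?_
    simp only [Nat.cast_ofNat, Nat.add_one_sub_one, pow_one, one_mul]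
    ring
  have := image_le_of_deriv_right_le_deriv_boundary (a := (0 : ℝ)) (b := 1)
    (f := fun s : ℝ => f (u + s • w)) (f' := fun t => inner ℝ (gradient f (u + t • w)) w)
    (fun t _ => (hd t).continuousAt.continuousWithinAt)
    (fun t _ => (hd t).hasDerivWithinAt)
    (B := fun s : ℝ => f u + s * inner ℝ (gradient f u) w + L / 2 * s ^ 2 * ‖w‖ ^ 2)
    (B' := fun t => inner ℝ (gradient f u) w + L * t * ‖w‖ ^ 2)
    (by simp)
    (fun t _ => (hB t).continuousAt.continuousWithinAt)
    (fun t _ => (hB t).hasDerivWithinAt)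
    (fun t ht => by
      have h1 : inner ℝ (gradient f (u + t • w) - gradient f u) w ≤ L * ‖t • w‖ * ‖w‖ := by
        refine (real_inner_le_norm _ _).trans ?_
        gcongr
        simpa using hf.2 (u + t • w) u
      rw [inner_sub_left, norm_smul, Real.norm_eq_abs, abs_of_nonneg ht.1] at h1
      nlinarith)
    (Set.right_mem_Icc.2 zero_le_one)
  simpa [hw] using this

/-- A strongly convex function lies above every tangent quadratic. It suffices that `p` is a
subgradient at `u`. -/
lemma StrongConvexOn.quadratic_le {m : ℝ} {f : E d → ℝ} (hf : StrongConvexOn Set.univ m f)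
    {u p : E d} (hp : ∀ v, f u + inner ℝ p (v - u) ≤ f v) (v : E d) :
    f u + inner ℝ p (v - u) + m / 2 * ‖v - u‖ ^ 2 ≤ f v := by
  refine add_le_of_forall_add_one_sub_mul_le fun t ht0 ht1 => ?_
  have h1 := hf.2 (Set.mem_univ u) (Set.mem_univ v) (by linarith : (0 : ℝ) ≤ 1 - t) ht0.le (by ring)
  have h2 := hp ((1 - t) • u + t • v)
  have h3 : (1 - t) • u + t • v - u = t • (v - u) := by module
  rw [h3, inner_smul_right] at h2
  simp only [smul_eq_mul] at h1
  rw [norm_sub_rev u v] at h1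
  refine le_of_mul_le_mul_left (a := t) ?_ ht0
  nlinarith

lemma IsSmooth.subgradient {L : ℝ} {f : E d → ℝ} (hf : IsSmooth L f)
    (hc : ConvexOn ℝ Set.univ f) (u v : E d) :
    f u + inner ℝ (gradient f u) (v - u) ≤ f v := by
  have hconv : ConvexOn ℝ Set.univ fun s : ℝ => f (u + s • (v - u)) := by
    refine ⟨convex_univ, fun s _ t _ a b ha hb hab => ?_⟩
    have h1 := hc.2 (Set.mem_univ (u + s • (v - u))) (Set.mem_univ (u + t • (v - u))) ha hb hab
    convert h1 using 2
    obtain rfl : a = 1 - b := by linarith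
    simp only [smul_eq_mul]
    module
  have h1 := hconv.le_slope_of_hasDerivAt (Set.mem_univ 0) (Set.mem_univ 1) zero_lt_one
    (hf.hasDerivAt_line u (v - u) 0)
  simp only [slope_def_field, zero_smul, add_zero, one_smul, sub_zero, div_one,
    add_sub_cancel] at h1
  linarith

end ConvexAnalysis

section Acceleration
variable {d : ℕ}

/-! ### One accelerated proximal gradient step -/

/-- A proximal gradient step from `z` whose gradient `p` is perturbed by the error `e`, compared with
an arbitrary point `u` of the domain. -/
lemma prox_step {L μ : ℝ} (hL : 0 < L) {h : E d → EReal} (hh : IsProperConvexLSC h)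
    {φ : E d → ℝ} {z p e y : E d} (hy : y = prox (1 / L) h (z - (1 / L) • (p + e)))
    (hupper : ∀ u, φ u ≤ φ z + inner ℝ p (u - z) + L / 2 * ‖u - z‖ ^ 2)
    (hlower : ∀ u, φ z + inner ℝ p (u - z) + μ / 2 * ‖u - z‖ ^ 2 ≤ φ u) :
    h y ≠ ⊤ ∧ ∀ u, h u ≠ ⊤ →
      φ y + (h y).toReal ≤ φ u + (h u).toReal + L * inner ℝ (y - z) (u - y)
        + L / 2 * ‖y - z‖ ^ 2 + inner ℝ e (u - y) - μ / 2 * ‖u - z‖ ^ 2 := by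
  obtain ⟨h1, h2⟩ := prox_spec hL hh (z - (1 / L) • (p + e))
  rw [← hy] at h1 h2
  refine ⟨h1, fun u hu => ?_⟩
  have h3 := h2 u hu
  have h4 : z - (1 / L) • (p + e) - y = -(y - z) - (1 / L) • (p + e) := by abel
  rw [h4, inner_sub_left, inner_neg_left, inner_smul_left, inner_add_left] at h3
  have h5 : L * (-inner ℝ (y - z) (u - y) - (starRingEnd ℝ) (1 / L) *
      (inner ℝ p (u - y) + inner ℝ e (u - y)))
      = -(L * inner ℝ (y - z) (u - y)) - inner ℝ p (u - y) - inner ℝ e (u - y) := by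
    simp only [conj_trivial]
    field_simp
    ring
  rw [h5] at h3
  have h6 : inner ℝ p (u - z) = inner ℝ p (u - y) + inner ℝ p (y - z) := by
    rw [← inner_add_right]; congr 1; abel
  have h7 := hupper y
  have h8 := hlower u
  linarith

lemma norm_sq_add_smul_le {a b : ℝ} (ha : 0 ≤ a) (hb : 0 ≤ b) (u v : E d) :
    ‖a • u + b • v‖ ^ 2 ≤ (a + b) * (a * ‖u‖ ^ 2 + b * ‖v‖ ^ 2) := by
  have h1 : ‖a • u + b • v‖ ^ 2 = (a + b) * (a * ‖u‖ ^ 2 + b * ‖v‖ ^ 2) - a * b * ‖u - v‖ ^ 2 := by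
    rw [norm_add_sq_real, norm_sub_sq_real, norm_smul, norm_smul, inner_smul_left,
      inner_smul_right]
    simp only [mul_pow, Real.norm_eq_abs, sq_abs, conj_trivial]
    ring
  have h2 : 0 ≤ a * b * ‖u - v‖ ^ 2 := by positivity
  linarith

/-- The completed square `L ⟨y - u, w - y⟩ + L/2 ‖y - u‖² = L/2 ‖w - u‖² - L/2 ‖w - y‖²`. -/
lemma inner_add_half_norm_sq (L : ℝ) (y u w : E d) :
    L * inner ℝ (y - u) (w - y) + L / 2 * ‖y - u‖ ^ 2 =
      L / 2 * ‖w - u‖ ^ 2 - L / 2 * ‖w - y‖ ^ 2 := by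
  have h : w - u = (y - u) + (w - y) := by abel
  rw [h, norm_add_sq_real]
  ring

/-- The contraction of the Lyapunov function `D + γ/2 ‖v - s‖²` under one accelerated step with
gradient error `e`, where `D` is the optimality gap at `w`, `s` is the solution, `u` is the
extrapolated point, `y` is the next iterate, and `w + (y - w) / t` is the next value of `v`. -/
lemma lyapunov_step {L μ t γ D D' : ℝ} (hL : 0 < L) (hμ : 0 ≤ μ) (ht : 0 < t) (ht1 : t ≤ 1)
    (hγ : 0 ≤ γ) (hLt : L * t ^ 2 = (1 - t) * γ + μ * t) {u v w s y e : E d}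
    (hu : (γ + t * μ) • u = (t * γ) • v + (L * t ^ 2) • w)
    (hw : D' ≤ D + L * inner ℝ (y - u) (w - y) + L / 2 * ‖y - u‖ ^ 2 + inner ℝ e (w - y)
      - μ / 2 * ‖w - u‖ ^ 2)
    (hs : D' ≤ L * inner ℝ (y - u) (s - y) + L / 2 * ‖y - u‖ ^ 2 + inner ℝ e (s - y)
      - μ / 2 * ‖s - u‖ ^ 2) :
    D' + L * t ^ 2 / 2 * ‖w + (1 / t) • (y - w) - s‖ ^ 2 ≤
      (1 - t) * (D + γ / 2 * ‖v - s‖ ^ 2)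
        + t * inner ℝ e (s - (w + (1 / t) • (y - w))) := by
  set v' := w + (1 / t) • (y - w) with hv'
  set W := (1 - t) • w + t • s with hW
  have hWy : W - y = t • (s - v') := by
    rw [hv', hW]
    simp only [smul_sub, smul_add, smul_smul]
    rw [mul_one_div_cancel ht.ne']
    module
  have h1 : ∀ x : E d, (1 - t) * inner ℝ x (w - y) + t * inner ℝ x (s - y)
      = inner ℝ x (W - y) := by
    intro x
    rw [← inner_smul_right, ← inner_smul_right, ← inner_add_right]
    congr 1
    rw [hW]; module
  have h2 := inner_add_half_norm_sq L y u W
  have h3 : (L * t) • (W - u) = ((1 - t) * γ) • (s - v) + (t * μ) • (s - u) := by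
    have hw' : (L * t ^ 2) • w = (γ + t * μ) • u - (t * γ) • v := by rw [hu]; abel
    have e1 : t • ((L * t) • (W - u))
        = (1 - t) • ((L * t ^ 2) • w) + (t * (L * t ^ 2)) • s - (L * t ^ 2) • u := by
      rw [hW]; module
    have e2 : t • ((L * t) • (W - u))
        = t • (((1 - t) * γ) • (s - v) + (t * μ) • (s - u)) := by
      rw [e1, hw', hLt]; module
    exact smul_right_injective _ ht.ne' e2
  have h4 : L * ‖W - u‖ ^ 2 ≤ (1 - t) * γ * ‖v - s‖ ^ 2 + t * μ * ‖s - u‖ ^ 2 := by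
    have e1 := norm_sq_add_smul_le (a := (1 - t) * γ) (b := t * μ)
      (mul_nonneg (by linarith) hγ) (by positivity) (s - v) (s - u)
    rw [← h3, norm_smul, mul_pow, Real.norm_eq_abs, sq_abs, mul_comm t μ, ← hLt,
      norm_sub_rev s v] at e1
    refine le_of_mul_le_mul_left (a := L * t ^ 2) ?_ (by positivity)
    linarith
  have h5 : ‖W - y‖ ^ 2 = t ^ 2 * ‖v' - s‖ ^ 2 := by
    rw [hWy, norm_smul, mul_pow, Real.norm_eq_abs, sq_abs, norm_sub_rev]
  have h6 : inner ℝ e (W - y) = t * inner ℝ e (s - v') := by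
    rw [hWy, inner_smul_right]
  have h7 : 0 ≤ (1 - t) * (μ / 2 * ‖w - u‖ ^ 2) :=
    mul_nonneg (by linarith) (by positivity)
  have h8 := mul_le_mul_of_nonneg_left hw (by linarith : 0 ≤ 1 - t)
  have h9 := mul_le_mul_of_nonneg_left hs ht.le
  have h10 := h1 (y - u)
  have h11 := h1 e
  rw [h5] at h2
  rw [h6] at h11
  have h12 : L * ((1 - t) * inner ℝ (y - u) (w - y) + t * inner ℝ (y - u) (s - y))
      = L * inner ℝ (y - u) (W - y) := by rw [h10]
  linarith

end Acceleration

namespace Problem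
variable {dx dy : ℕ} {P : Problem dx dy}

/-! ### The subproblems and the dual function -/

lemma inner_Bt (P : Problem dx dy) (y : E dy) (x : E dx) :
    inner ℝ (P.Bt y) x = inner ℝ y (P.B x) :=
  ContinuousLinearMap.adjoint_inner_left P.B x y

lemma norm_B_le (P : Problem dx dy) (x : E dx) : ‖P.B x‖ ≤ P.σ * ‖x‖ := P.B.le_opNorm x

lemma inner_B_le (P : Problem dx dy) (y : E dy) (x : E dx) :
    inner ℝ y (P.B x) ≤ P.σ * ‖y‖ * ‖x‖ := by
  refine (real_inner_le_norm _ _).trans ?_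
  have := mul_le_mul_of_nonneg_left (P.norm_B_le x) (norm_nonneg y)
  linarith

namespace Assumptions

lemma σ_pos (h : P.Assumptions) : 0 < P.σ := norm_pos_iff.2 h.B_ne_zero

lemma Lφ_pos (h : P.Assumptions) : 0 < P.Lφ := by
  have := h.σ_pos
  have := h.μx_pos
  have := h.Ly_nonneg
  unfold Problem.Lφ
  positivity

lemma strongConvexOn_sub (h : P.Assumptions) (z : E dy) :
    StrongConvexOn Set.univ P.μx fun x => P.f₁ x + inner ℝ (P.Bt z) x := by
  refine ⟨convex_univ, fun u hu v hv a b ha hb hab => ?_⟩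
  have h1 := h.f₁_strong.2 hu hv ha hb hab
  simp only [smul_eq_mul, inner_add_right, inner_smul_right] at h1 ⊢
  linarith

lemma continuous_f₁ (h : P.Assumptions) : Continuous P.f₁ := h.f₁_smooth.1.continuous

lemma xStar_spec (h : P.Assumptions) (z : E dy) :
    P.f₂ (P.xStar z) ≠ ⊤ ∧ ∀ x, P.f₂ x ≠ ⊤ →
      P.f₁ (P.xStar z) + inner ℝ (P.Bt z) (P.xStar z) + (P.f₂ (P.xStar z)).toReal
        + P.μx / 2 * ‖x - P.xStar z‖ ^ 2 ≤ P.f₁ x + inner ℝ (P.Bt z) x + (P.f₂ x).toReal :=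
  argmin_spec h.μx_pos (h.strongConvexOn_sub z)
    (h.continuous_f₁.add (by fun_prop)) h.f₂_pcl (F := P.subObj z) fun _ => rfl

lemma xStar_lipschitz (h : P.Assumptions) (z z' : E dy) :
    ‖P.xStar z - P.xStar z'‖ ≤ P.σ / P.μx * ‖z - z'‖ := by
  obtain ⟨h1, h2⟩ := h.xStar_spec z
  obtain ⟨h1', h2'⟩ := h.xStar_spec z'
  have h3 := h2 _ h1'
  have h4 := h2' _ h1
  have h5 := P.inner_B_le (z' - z) (P.xStar z - P.xStar z')
  rw [norm_sub_rev z' z] at h5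
  simp only [P.inner_Bt, map_sub, inner_sub_left, inner_sub_right] at h3 h4 h5
  rw [norm_sub_rev (P.xStar z') (P.xStar z)] at h3
  rcases (norm_nonneg (P.xStar z - P.xStar z')).eq_or_lt with h0 | h0
  · rw [← h0]
    have := h.σ_pos
    have := h.μx_pos
    positivity
  · have h6 : P.μx * ‖P.xStar z - P.xStar z'‖ ≤ P.σ * ‖z - z'‖ := by
      refine le_of_mul_le_mul_right (a := ‖P.xStar z - P.xStar z'‖) ?_ h0
      nlinarith
    rw [div_mul_eq_mul_div, le_div_iff₀ h.μx_pos]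
    linarith

/-- The supremum that defines the conjugate in `φ(y)` is attained at `x*(y)`. -/
lemma φ_eq (h : P.Assumptions) (y : E dy) :
    P.φ y = ((P.g₁ y - (P.f₁ (P.xStar y) + inner ℝ (P.Bt y) (P.xStar y)
      + (P.f₂ (P.xStar y)).toReal) : ℝ) : EReal) := by
  obtain ⟨h1, h2⟩ := h.xStar_spec y
  have hval : ∀ x, P.f₂ x ≠ ⊤ → ((inner ℝ (-(P.Bt y)) x : ℝ) : EReal) - ((P.f₁ x : EReal) + P.f₂ x)
      = ((-(P.f₁ x + inner ℝ (P.Bt y) x + (P.f₂ x).toReal) : ℝ) : EReal) := by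
    intro x hx
    rw [← h.f₂_pcl.coe_toReal hx, ← EReal.coe_add, ← EReal.coe_sub, EReal.toReal_coe,
      inner_neg_left]
    congr 1
    ring
  have hconj : conjugate (fun x => (P.f₁ x : EReal) + P.f₂ x) (-(P.Bt y))
      = ((-(P.f₁ (P.xStar y) + inner ℝ (P.Bt y) (P.xStar y)
        + (P.f₂ (P.xStar y)).toReal) : ℝ) : EReal) := by
    refine le_antisymm (iSup_le fun x => ?_) ?_
    · by_cases hx : P.f₂ x = ⊤
      · simp [hx]
      · rw [hval x hx]
        refine EReal.coe_le_coe_iff.2 (neg_le_neg ?_)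
        have := h2 x hx
        have : 0 ≤ P.μx / 2 * ‖x - P.xStar y‖ ^ 2 := by
          have := h.μx_pos
          positivity
        linarith
    · rw [← hval _ h1]
      exact le_iSup (fun x => ((inner ℝ (-(P.Bt y)) x : ℝ) : EReal) - ((P.f₁ x : EReal) + P.f₂ x)) _
  rw [Problem.φ, hconj, ← EReal.coe_add, sub_eq_add_neg]

lemma coe_toReal_φ (h : P.Assumptions) (y : E dy) : ((P.φ y).toReal : EReal) = P.φ y := by
  rw [h.φ_eq, EReal.toReal_coe]

lemma toReal_φ (h : P.Assumptions) (y : E dy) :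
    (P.φ y).toReal = P.g₁ y - (P.f₁ (P.xStar y) + inner ℝ (P.Bt y) (P.xStar y)
      + (P.f₂ (P.xStar y)).toReal) := by
  rw [h.φ_eq, EReal.toReal_coe]

/-- `∇g₁(z) - B x*(z)` is a subgradient of `φ` at `z`, because `x*(z)` is a competitor in the
subproblem at every other point. -/
lemma φ_lower (h : P.Assumptions) (z u : E dy) :
    (P.φ z).toReal + inner ℝ (gradient P.g₁ z - P.B (P.xStar z)) (u - z)
      + P.μφ / 2 * ‖u - z‖ ^ 2 ≤ (P.φ u).toReal := by
  refine StrongConvexOn.quadratic_le h.φ_strong (fun v => ?_) u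
  have h1 := h.g₁_smooth.subgradient h.g₁_convex z v
  have h2 := (h.xStar_spec v).2 _ (h.xStar_spec z).1
  have h3 : 0 ≤ P.μx / 2 * ‖P.xStar z - P.xStar v‖ ^ 2 := by
    have := h.μx_pos
    positivity
  rw [h.toReal_φ, h.toReal_φ, inner_sub_left, real_inner_comm (v - z) (P.B _), inner_sub_left v]
  simp only [P.inner_Bt] at h2 ⊢
  linarith

/-- The quadratic upper bound uses the growth of the subproblem at `z` around `x*(z)`. -/
lemma φ_upper (h : P.Assumptions) (z u : E dy) :
    (P.φ u).toReal ≤ (P.φ z).toReal + inner ℝ (gradient P.g₁ z - P.B (P.xStar z)) (u - z)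
      + P.Lφ / 2 * ‖u - z‖ ^ 2 := by
  have h1 := h.g₁_smooth.le_quadratic z u
  have h2 := (h.xStar_spec z).2 _ (h.xStar_spec u).1
  have h3 := P.inner_B_le (z - u) (P.xStar u - P.xStar z)
  have hμ := h.μx_pos
  -- Young's inequality for the cross term `⟨u - z, B (x*(u) - x*(z))⟩`
  have h4 : P.σ * ‖u - z‖ * ‖P.xStar u - P.xStar z‖ ≤
      P.σ ^ 2 / P.μx / 2 * ‖u - z‖ ^ 2 + P.μx / 2 * ‖P.xStar u - P.xStar z‖ ^ 2 := by
    have := sq_nonneg (P.σ * ‖u - z‖ - P.μx * ‖P.xStar u - P.xStar z‖)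
    have h5 : P.σ ^ 2 / P.μx / 2 * ‖u - z‖ ^ 2 + P.μx / 2 * ‖P.xStar u - P.xStar z‖ ^ 2
        - P.σ * ‖u - z‖ * ‖P.xStar u - P.xStar z‖
        = (P.σ * ‖u - z‖ - P.μx * ‖P.xStar u - P.xStar z‖) ^ 2 / (2 * P.μx) := by
      field_simp
      ring
    have h6 : 0 ≤ (P.σ * ‖u - z‖ - P.μx * ‖P.xStar u - P.xStar z‖) ^ 2 / (2 * P.μx) := by
      positivity
    linarith
  rw [h.toReal_φ, h.toReal_φ, inner_sub_left, real_inner_comm (u - z) (P.B _), inner_sub_left u]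
  rw [norm_sub_rev z u, map_sub, inner_sub_right, inner_sub_left, inner_sub_left] at h3
  simp only [P.inner_Bt] at h2 ⊢
  unfold Problem.Lφ
  linarith

/-- The dual space is nontrivial because `B ≠ 0`, so the two quadratics of `φ_lower` and `φ_upper`
differ somewhere. -/
lemma μφ_le_Lφ (h : P.Assumptions) : P.μφ ≤ P.Lφ := by
  obtain ⟨x, hx⟩ : ∃ x, P.B x ≠ 0 := by
    by_contra! H
    exact h.B_ne_zero (ContinuousLinearMap.ext H)
  have h1 := (h.φ_lower 0 (P.B x)).trans (h.φ_upper 0 (P.B x))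
  have h2 : 0 < ‖P.B x - 0‖ ^ 2 := by
    rw [sub_zero]
    have := norm_pos_iff.2 hx
    positivity
  nlinarith

lemma κφ_eq (h : P.Assumptions) : P.κφ = P.Lφ / P.μφ := by
  have := h.μx_pos
  have := h.μφ_pos
  unfold κφ Problem.Lφ
  field_simp
  ring

lemma one_le_κφ (h : P.Assumptions) : 1 ≤ P.κφ := by
  rw [h.κφ_eq, one_le_div h.μφ_pos]
  exact h.μφ_le_Lφ

lemma one_le_sqrt_κφ (h : P.Assumptions) : 1 ≤ √P.κφ := Real.one_le_sqrt.2 h.one_le_κφ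

lemma one_le_κx (h : P.Assumptions) : 1 ≤ P.κx := by
  rw [κx, one_le_div h.μx_pos]
  exact h.μx_le_Lx

/-! ### Saddle points -/

lemma xStar_saddle (h : P.Assumptions) {xs : E dx} {ys : E dy} (hs : P.IsSaddle xs ys) :
    P.xStar ys = xs := by
  obtain ⟨h1, h2⟩ := h.xStar_spec ys
  have h3 := hs.min_x (P.xStar ys)
  unfold lagr at h3
  rw [← h.f₂_pcl.coe_toReal hs.x_dom, ← h.g₂_pcl.coe_toReal hs.y_dom,
    ← h.f₂_pcl.coe_toReal h1] at h3
  norm_cast at h3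
  have h4 := h2 xs hs.x_dom
  simp only [P.inner_Bt] at h4
  have h5 : P.μx / 2 * ‖xs - P.xStar ys‖ ^ 2 ≤ 0 := by linarith
  have h6 : ‖xs - P.xStar ys‖ ^ 2 ≤ 0 := by
    have := h.μx_pos
    by_contra! H
    have : 0 < P.μx / 2 * ‖xs - P.xStar ys‖ ^ 2 := by positivity
    linarith
  have h7 : ‖xs - P.xStar ys‖ = 0 := by
    have := norm_nonneg (xs - P.xStar ys)
    nlinarith
  exact (sub_eq_zero.1 (norm_eq_zero.1 h7)).symm

/-- The dual solution minimizes `Φ`, which grows quadratically around it. -/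
lemma Φ_growth (h : P.Assumptions) {xs : E dx} {ys : E dy} (hs : P.IsSaddle xs ys) {y : E dy}
    (hy : P.g₂ y ≠ ⊤) :
    (P.φ ys).toReal + (P.g₂ ys).toReal + P.μφ / 2 * ‖y - ys‖ ^ 2 ≤
      (P.φ y).toReal + (P.g₂ y).toReal := by
  have hmin : ∀ u, P.g₂ u ≠ ⊤ →
      (P.φ ys).toReal + (P.g₂ ys).toReal ≤ (P.φ u).toReal + (P.g₂ u).toReal := by
    intro u hu
    have h2 := (h.xStar_spec u).2 _ hs.x_dom
    have h3 := hs.max_y u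
    unfold lagr at h3
    rw [← h.f₂_pcl.coe_toReal hs.x_dom, ← h.g₂_pcl.coe_toReal hs.y_dom,
      ← h.g₂_pcl.coe_toReal hu] at h3
    norm_cast at h3
    rw [h.toReal_φ, h.toReal_φ, h.xStar_saddle hs]
    have h4 : 0 ≤ P.μx / 2 * ‖xs - P.xStar u‖ ^ 2 := by
      have := h.μx_pos
      positivity
    simp only [P.inner_Bt] at h2 ⊢
    linarith
  have hcoe : ∀ u, P.g₂ u ≠ ⊤ → (((P.φ u).toReal : ℝ) : EReal) + P.g₂ u
      = (((P.φ u).toReal + (P.g₂ u).toReal : ℝ) : EReal) := by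
    intro u hu
    rw [EReal.coe_add, h.g₂_pcl.coe_toReal hu]
  refine (isStronglyConvex_add h.φ_strong h.g₂_pcl).growth (fun u _ => ?_)
    (hcoe ys hs.y_dom) (hcoe y hy)
  change (((P.φ ys).toReal : ℝ) : EReal) + P.g₂ ys ≤ (((P.φ u).toReal : ℝ) : EReal) + P.g₂ u
  by_cases hu : P.g₂ u = ⊤
  · simp [hu]
  · rw [hcoe u hu, hcoe ys hs.y_dom]
    exact EReal.coe_le_coe_iff.2 (hmin u hu)

lemma gap_eq (h : P.Assumptions) {y ys : E dy} (hy : P.g₂ y ≠ ⊤) (hys : P.g₂ ys ≠ ⊤) :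
    P.gap y ys = (P.φ y).toReal + (P.g₂ y).toReal - ((P.φ ys).toReal + (P.g₂ ys).toReal) := by
  unfold gap Φ
  rw [← h.coe_toReal_φ y, ← h.coe_toReal_φ ys, ← h.g₂_pcl.coe_toReal hy,
    ← h.g₂_pcl.coe_toReal hys]
  norm_cast

lemma gap_growth (h : P.Assumptions) {xs : E dx} {ys : E dy} (hs : P.IsSaddle xs ys) {y : E dy}
    (hy : P.g₂ y ≠ ⊤) : P.μφ / 2 * ‖y - ys‖ ^ 2 ≤ P.gap y ys := by
  rw [h.gap_eq hy hs.y_dom]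
  linarith [h.Φ_growth hs hy]

lemma gap_nonneg (h : P.Assumptions) {xs : E dx} {ys : E dy} (hs : P.IsSaddle xs ys) {y : E dy}
    (hy : P.g₂ y ≠ ⊤) : 0 ≤ P.gap y ys := by
  refine le_trans ?_ (h.gap_growth hs hy)
  have := h.μφ_pos
  positivity

end Assumptions

end Problem

namespace Problem
variable {dx dy : ℕ} {P : Problem dx dy}

/-! ### The parameters of the outer method -/

namespace Assumptions

lemma sqrt_κφ_pos (h : P.Assumptions) : 0 < √P.κφ := zero_lt_one.trans_le h.one_le_sqrt_κφ

lemma one_sub_inv_sqrt_κφ_nonneg (h : P.Assumptions) : 0 ≤ 1 - 1 / √P.κφ := by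
  rw [sub_nonneg, div_le_one h.sqrt_κφ_pos]
  exact h.one_le_sqrt_κφ

lemma one_sub_inv_le_θ (h : P.Assumptions) {c : ℝ} (hc : 1 < c) : 1 - 1 / c ≤ P.θ c := by
  unfold θ
  have h1 := h.one_le_sqrt_κφ
  have : 1 / (c * √P.κφ) ≤ 1 / c := by
    apply one_div_le_one_div_of_le <;> nlinarith
  linarith

lemma one_sub_inv_pos {c : ℝ} (hc : 1 < c) : 0 < 1 - 1 / c := by
  rw [sub_pos, div_lt_one (by linarith)]
  exact hc

lemma θ_pos (h : P.Assumptions) {c : ℝ} (hc : 1 < c) : 0 < P.θ c :=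
  (one_sub_inv_pos hc).trans_le (h.one_sub_inv_le_θ hc)

lemma θ_le_one (h : P.Assumptions) {c : ℝ} (hc : 1 < c) : P.θ c ≤ 1 := by
  unfold θ
  have h1 := h.sqrt_κφ_pos
  have : 0 ≤ 1 / (c * √P.κφ) := by positivity
  linarith

/-- The margin `θ - (1 - 1/√κ_φ)` between the tolerance rate and the exact rate. -/
lemma θ_sub (P : Problem dx dy) (c : ℝ) :
    P.θ c - (1 - 1 / √P.κφ) = (1 - 1 / c) * (1 / √P.κφ) := by
  unfold θ
  rw [← div_div]
  ring

lemma sqrt_lt_sqrt_θ (h : P.Assumptions) {c : ℝ} (hc : 1 < c) :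
    √(1 - 1 / √P.κφ) < √(P.θ c) := by
  refine Real.sqrt_lt_sqrt h.one_sub_inv_sqrt_κφ_nonneg ?_
  have h1 := θ_sub P c
  have h2 := mul_pos (one_sub_inv_pos hc) (one_div_pos.2 h.sqrt_κφ_pos)
  linarith

/-- A lower bound for the margin `√θ - √(1 - 1/√κ_φ)` of the tolerance `ε₁`. -/
lemma le_sqrt_θ_sub (h : P.Assumptions) {c : ℝ} (hc : 1 < c) :
    (1 - 1 / c) / (2 * √P.κφ) ≤ √(P.θ c) - √(1 - 1 / √P.κφ) := by
  have h1 := h.sqrt_lt_sqrt_θ hc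
  have h2 : √(P.θ c) ≤ 1 := Real.sqrt_le_one.2 (h.θ_le_one hc)
  have h3 := θ_sub P c
  have h4 := Real.sq_sqrt (h.θ_pos hc).le
  have h5 := Real.sq_sqrt h.one_sub_inv_sqrt_κφ_nonneg
  have h6 : (1 - 1 / c) / (2 * √P.κφ) = ((1 - 1 / c) * (1 / √P.κφ)) / 2 := by ring
  rw [h6, ← h3]
  nlinarith

lemma C_pos (h : P.Assumptions) {c : ℝ} (hc : 1 < c) : 0 < P.C c := by
  have h1 := h.σ_pos
  have h2 := h.μφ_pos
  have h3 := h.μx_pos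
  have h4 := h.one_le_κφ
  have h5 := sub_pos.2 (h.sqrt_lt_sqrt_θ hc)
  have h6 : 0 ≤ √(1 - 1 / √P.κφ) := Real.sqrt_nonneg _
  unfold Problem.C
  positivity

lemma Lφ_mul_sq (h : P.Assumptions) : P.Lφ * (1 / √P.κφ) ^ 2 = P.μφ := by
  have h1 := h.one_le_κφ
  have h2 := h.μφ_pos
  have h3 := h.Lφ_pos
  rw [div_pow, one_pow, Real.sq_sqrt (by linarith), h.κφ_eq]
  field_simp

end Assumptions

/-! ### Convergence of the outer iteration -/

/-- The auxiliary sequence `v⁰ = y⁰`, `vᵏ⁺¹ = yᵏ + √κ_φ (yᵏ⁺¹ - yᵏ)` of the Lyapunov function of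
accelerated gradient methods. -/
noncomputable def auxSeq (P : Problem dx dy) (y : ℕ → E dy) : ℕ → E dy
  | 0 => y 0
  | k + 1 => y k + √P.κφ • (y (k + 1) - y k)

/-- The induction step of the outer rate: a perturbed contraction `V' ≤ ρ V + a E n`, with an error
`E` that decays at a rate `√θ` slower than `√ρ` and a distance `n` that `V'` itself controls. -/
lemma lyapunov_rate_step {a μ Δ θ V V' E n T : ℝ} (ha : 0 ≤ a) (ha1 : a ≤ 1) (hμ : 0 ≤ μ)
    (hΔ : 0 ≤ Δ) (hρθ : √(1 - a) ≤ √θ) (hT : 0 ≤ T) (hn : 0 ≤ n)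
    (hV : V ≤ 2 * Δ * T ^ 2) (hV' : V' ≤ (1 - a) * V + a * (E * n))
    (hE : E ≤ T * ((√θ - √(1 - a)) * √(μ * Δ))) (hnV : μ / 2 * n ^ 2 ≤ V') :
    V' ≤ 2 * Δ * (T * √θ) ^ 2 := by
  have hV'0 : 0 ≤ V' := le_trans (by positivity) hnV
  set r := √(1 - a) with hr
  set τ := √θ with hτ
  have hr2 : r ^ 2 = 1 - a := Real.sq_sqrt (by linarith)
  have hr0 : 0 ≤ r := Real.sqrt_nonneg _
  set X := √V' with hX
  have hX2 : X ^ 2 = V' := Real.sq_sqrt hV'0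
  have hX0 : 0 ≤ X := Real.sqrt_nonneg _
  set G := T * √(2 * Δ) with hG
  have hG0 : 0 ≤ G := by positivity
  have hG2 : G ^ 2 = 2 * Δ * T ^ 2 := by
    rw [hG, mul_pow, Real.sq_sqrt (by positivity)]; ring
  have hn' : √(μ / 2) * n ≤ X := by
    refine Real.le_sqrt_of_sq_le ?_
    rw [mul_pow, Real.sq_sqrt (by positivity)]
    exact hnV
  have hsplit : √(μ * Δ) = √(μ / 2) * √(2 * Δ) := by
    rw [← Real.sqrt_mul (by positivity)]
    congr 1
    ring
  have hτr : 0 ≤ τ - r := by linarith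
  have h1 : E * n ≤ (τ - r) * G * X := by
    calc E * n ≤ T * ((τ - r) * √(μ * Δ)) * n := by gcongr
      _ = (τ - r) * G * (√(μ / 2) * n) := by rw [hsplit, hG]; ring
      _ ≤ (τ - r) * G * X := by gcongr
  have h2 : a * (E * n) ≤ (τ - r) * G * X := by
    have h3 : 0 ≤ (τ - r) * G * X := mul_nonneg (mul_nonneg hτr hG0) hX0
    calc a * (E * n) ≤ a * ((τ - r) * G * X) := by gcongr
      _ ≤ 1 * ((τ - r) * G * X) := by gcongr
      _ = _ := one_mul _
  have h3 : X ^ 2 ≤ r ^ 2 * G ^ 2 + (τ - r) * G * X := by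
    rw [hX2, hr2, hG2]
    have : (1 - a) * V ≤ (1 - a) * (2 * Δ * T ^ 2) :=
      mul_le_mul_of_nonneg_left hV (by linarith)
    linarith
  have h4 : X ≤ τ * G := by
    by_contra! H
    have h5 : 0 ≤ τ * G := by positivity
    have h6 : 0 < (X - τ * G) * (X + r * G) :=
      mul_pos (by linarith) (add_pos_of_pos_of_nonneg (by linarith) (by positivity))
    have h7 : 0 ≤ r * G ^ 2 * (τ - r) := mul_nonneg (mul_nonneg hr0 (sq_nonneg G)) hτr
    nlinarith
  calc V' = X ^ 2 := hX2.symm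
    _ ≤ (τ * G) ^ 2 := by gcongr
    _ = τ ^ 2 * G ^ 2 := by ring
    _ = 2 * Δ * (T * τ) ^ 2 := by rw [hG2]; ring

namespace Assumptions

section Outer
variable {c : ℝ} {xs : E dx} {ys y0 : E dy} {x : ℕ → E dx} {y z : ℕ → E dy}

lemma y_dom (h : P.Assumptions) (hit : P.IsIDAPG x y z) (hy0 : P.g₂ (y 0) ≠ ⊤) (k : ℕ) :
    P.g₂ (y k) ≠ ⊤ := by
  cases k with
  | zero => exact hy0
  | succ k =>
    rw [hit.y_succ k]
    exact (prox_spec h.Lφ_pos h.g₂_pcl _).1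

/-- The relation between `z`, `v` and `y` on which the Lyapunov argument rests. -/
lemma smul_z_eq (h : P.Assumptions) (hit : P.IsIDAPG x y z) (k : ℕ) :
    (P.μφ + 1 / √P.κφ * P.μφ) • z k = (1 / √P.κφ * P.μφ) • P.auxSeq y k + P.μφ • y k := by
  cases k with
  | zero =>
    rw [hit.z_zero]
    simp only [auxSeq]
    module
  | succ k =>
    have h1 := h.sqrt_κφ_pos
    have h2 : (P.μφ + 1 / √P.κφ * P.μφ) * P.β = (1 - 1 / √P.κφ) * P.μφ := by
      unfold Problem.β
      field_simp
    have h3 : 1 / √P.κφ * P.μφ * √P.κφ = P.μφ := by field_simp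
    rw [hit.z_succ, auxSeq, smul_add, smul_smul, h2, smul_add, smul_smul, h3]
    module

/-- The gap and the auxiliary distance of the outer iterates decay at the rate `θ`. -/
lemma outer_rate (h : P.Assumptions) (hc : 1 < c) (hs : P.IsSaddle xs ys)
    (hit : P.IsIDAPG x y z) (hy : y 0 = y0) (hy0 : P.g₂ y0 ≠ ⊤)
    (hacc : ∀ k, P.Accurate c y0 ys k (z k) (x (k + 1))) (k : ℕ) :
    P.gap (y k) ys + P.μφ / 2 * ‖P.auxSeq y k - ys‖ ^ 2 ≤
      2 * P.gap y0 ys * (√(P.θ c) ^ k) ^ 2 := by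
  have hdom := h.y_dom hit (hy ▸ hy0)
  have hΔ := h.gap_nonneg hs hy0
  have hθ := h.θ_pos hc
  have ha0 : 0 < 1 / √P.κφ := one_div_pos.2 h.sqrt_κφ_pos
  have ha1 : 1 / √P.κφ ≤ 1 := by linarith [h.one_sub_inv_sqrt_κφ_nonneg]
  induction k with
  | zero =>
    simp only [auxSeq, hy, pow_zero]
    linarith [h.gap_growth hs hy0]
  | succ k ih =>
    set e := P.B (P.xStar (z k)) - P.B (x (k + 1)) with he
    obtain ⟨-, hstep⟩ := prox_step (μ := P.μφ) h.Lφ_pos h.g₂_pcl (φ := fun y => (P.φ y).toReal)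
      (z := z k) (p := gradient P.g₁ (z k) - P.B (P.xStar (z k))) (e := e) (y := y (k + 1))
      (by rw [hit.y_succ k, he, yStep]; congr 3; abel)
      (h.φ_upper (z k)) (h.φ_lower (z k))
    have hLa := h.Lφ_mul_sq
    have hly := lyapunov_step (L := P.Lφ) (μ := P.μφ) (t := 1 / √P.κφ) (γ := P.μφ)
      (D := P.gap (y k) ys) (D' := P.gap (y (k + 1)) ys) (u := z k) (v := P.auxSeq y k)
      (w := y k) (s := ys) (y := y (k + 1)) (e := e)
      h.Lφ_pos h.μφ_pos.le ha0 ha1 h.μφ_pos.le (by rw [hLa]; ring)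
      (by rw [hLa]; exact h.smul_z_eq hit k)
      (by
        have := hstep (y k) (hdom k)
        rw [h.gap_eq (hdom k) hs.y_dom, h.gap_eq (hdom (k + 1)) hs.y_dom]
        linarith)
      (by
        have := hstep ys hs.y_dom
        rw [h.gap_eq (hdom (k + 1)) hs.y_dom]
        linarith)
    rw [hLa] at hly
    have hv : y k + (1 / (1 / √P.κφ)) • (y (k + 1) - y k) = P.auxSeq y (k + 1) := by
      rw [one_div_one_div]; rfl
    rw [hv] at hly
    have hE : ‖e‖ ≤ √(P.θ c) ^ k * ((√(P.θ c) - √(1 - 1 / √P.κφ)) * √(P.μφ * P.gap y0 ys)) := by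
      have h1 : ‖e‖ ≤ P.σ * ‖x (k + 1) - P.xStar (z k)‖ := by
        rw [he, ← map_sub, norm_sub_rev (x (k + 1))]
        exact P.norm_B_le _
      have h2 := hacc k
      unfold Accurate at h2
      rw [le_div_iff₀ (pow_pos h.σ_pos 2)] at h2
      have h3 : (√(P.θ c) ^ k) ^ 2 = P.θ c ^ k := by
        rw [← pow_mul, mul_comm, pow_mul, Real.sq_sqrt hθ.le]
      have h4 := sub_pos.2 (h.sqrt_lt_sqrt_θ hc)
      refine h1.trans (le_of_sq_le_sq ?_ (by positivity))
      rw [mul_pow, mul_pow _ (_ * _) 2, h3]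
      unfold εSq ε₁ at h2
      linarith
    rw [pow_succ]
    refine lyapunov_rate_step (a := 1 / √P.κφ) (μ := P.μφ) (n := ‖P.auxSeq y (k + 1) - ys‖)
      (E := ‖e‖) (T := √(P.θ c) ^ k) ha0.le ha1 h.μφ_pos.le hΔ (h.sqrt_lt_sqrt_θ hc).le
      (by positivity) (norm_nonneg _) ih (hly.trans ?_) hE ?_
    · have := real_inner_le_norm e (ys - P.auxSeq y (k + 1))
      rw [norm_sub_rev ys] at this
      gcongr
    · linarith [h.gap_nonneg hs (hdom (k + 1))]

lemma norm_y_sub_le (h : P.Assumptions) (hc : 1 < c) (hs : P.IsSaddle xs ys)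
    (hit : P.IsIDAPG x y z) (hy : y 0 = y0) (hy0 : P.g₂ y0 ≠ ⊤)
    (hacc : ∀ k, P.Accurate c y0 ys k (z k) (x (k + 1))) (k : ℕ) :
    ‖y k - ys‖ ≤ √(4 * P.gap y0 ys / P.μφ) * √(P.θ c) ^ k := by
  have h1 := h.outer_rate hc hs hit hy hy0 hacc k
  have h2 := h.gap_growth hs (h.y_dom hit (hy ▸ hy0) k)
  have h3 := h.μφ_pos
  have hΔ := h.gap_nonneg hs hy0
  have h4 : 0 ≤ P.μφ / 2 * ‖P.auxSeq y k - ys‖ ^ 2 := by positivity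
  refine le_of_sq_le_sq ?_ (by positivity)
  rw [mul_pow, Real.sq_sqrt (by positivity)]
  have h5 : P.μφ / 2 * ‖y k - ys‖ ^ 2 ≤
      P.μφ / 2 * (4 * P.gap y0 ys / P.μφ * (√(P.θ c) ^ k) ^ 2) := by
    have : P.μφ / 2 * (4 * P.gap y0 ys / P.μφ * (√(P.θ c) ^ k) ^ 2)
        = 2 * P.gap y0 ys * (√(P.θ c) ^ k) ^ 2 := by
      field_simp
      ring
    linarith
  exact le_of_mul_le_mul_left h5 (by positivity)

/-- The extrapolation costs a factor of at most `3` over the rate of `norm_y_sub_le`; it is kept in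
the closed form in which it enters `𝒞`. -/
lemma norm_z_sub_le (h : P.Assumptions) (hc : 1 < c) (hs : P.IsSaddle xs ys)
    (hit : P.IsIDAPG x y z) (hy : y 0 = y0) (hy0 : P.g₂ y0 ≠ ⊤)
    (hacc : ∀ k, P.Accurate c y0 ys k (z k) (x (k + 1))) (k : ℕ) :
    ‖z k - ys‖ ≤ √P.κφ * (2 + √(1 - 1 / √P.κφ)) / (√P.κφ + 1)
      * (√(4 * P.gap y0 ys / P.μφ) * √(P.θ c) ^ k) := by
  have hy' := h.norm_y_sub_le hc hs hit hy hy0 hacc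
  have h1 := h.one_le_sqrt_κφ
  set R := √(4 * P.gap y0 ys / P.μφ)
  have hR : 0 ≤ R := Real.sqrt_nonneg _
  set q := √P.κφ with hq
  set r := √(1 - 1 / q) with hr
  have hr0 : 0 ≤ r := Real.sqrt_nonneg _
  have hr2 : r ^ 2 = 1 - 1 / q := Real.sq_sqrt h.one_sub_inv_sqrt_κφ_nonneg
  have hrτ : r ≤ √(P.θ c) := (h.sqrt_lt_sqrt_θ hc).le
  set τ := √(P.θ c)
  have hτ : 0 ≤ τ := Real.sqrt_nonneg _
  cases k with
  | zero =>
    rw [hit.z_zero]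
    refine (hy' 0).trans (le_mul_of_one_le_left (by positivity) ?_)
    rw [one_le_div (by linarith)]
    nlinarith
  | succ k =>
    have hβ : P.β = q / (q + 1) * r ^ 2 := by
      rw [hr2]
      unfold Problem.β
      rw [← hq]
      field_simp
    have hβ0 : 0 ≤ P.β := by rw [hβ]; positivity
    have hβ1 : 1 + P.β = 2 * q / (q + 1) := by
      unfold Problem.β
      rw [← hq]
      field_simp
      ring
    have e1 : z (k + 1) - ys = (1 + P.β) • (y (k + 1) - ys) - P.β • (y k - ys) := by
      rw [hit.z_succ]; module
    calc ‖z (k + 1) - ys‖ ≤ (1 + P.β) * ‖y (k + 1) - ys‖ + P.β * ‖y k - ys‖ := by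
          rw [e1]
          refine (norm_sub_le _ _).trans ?_
          rw [norm_smul, norm_smul, Real.norm_eq_abs, Real.norm_eq_abs, abs_of_nonneg hβ0,
            abs_of_nonneg (by linarith)]
      _ ≤ (1 + P.β) * (R * τ ^ (k + 1)) + P.β * (R * τ ^ k) := by
          gcongr
          · exact hy' _
          · exact hy' _
      _ = 2 * q / (q + 1) * (R * τ ^ (k + 1)) + q / (q + 1) * r * (R * (r * τ ^ k)) := by
          rw [hβ1, hβ]; ring
      _ ≤ 2 * q / (q + 1) * (R * τ ^ (k + 1)) + q / (q + 1) * r * (R * (τ * τ ^ k)) := by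
          gcongr
      _ = _ := by rw [pow_succ]; ring

/-- Accuracy `ε` is reached once `𝒞 Δ θᵏ ≤ ε`. -/
lemma reached_of_le (h : P.Assumptions) (hc : 1 < c) (hs : P.IsSaddle xs ys)
    (hit : P.IsIDAPG x y z) (hy : y 0 = y0) (hy0 : P.g₂ y0 ≠ ⊤)
    (hacc : ∀ k, P.Accurate c y0 ys k (z k) (x (k + 1))) {ε : ℝ} {k : ℕ}
    (hk : P.C c * P.gap y0 ys * P.θ c ^ k ≤ ε) : P.Reached xs ys ε x y k := by
  have hy' := h.norm_y_sub_le hc hs hit hy hy0 hacc k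
  have hz' := h.norm_z_sub_le hc hs hit hy hy0 hacc k
  have hx' := hacc k
  unfold Accurate at hx'
  have hlip := h.xStar_lipschitz (z k) ys
  rw [h.xStar_saddle hs] at hlip
  have hσ := h.σ_pos
  have hμx := h.μx_pos
  have hμφ := h.μφ_pos
  have hΔ := h.gap_nonneg hs hy0
  have hθ := h.θ_pos hc
  have h1 := h.one_le_sqrt_κφ
  have hκ2 : √P.κφ ^ 2 = P.κφ := Real.sq_sqrt (by linarith [h.one_le_κφ])
  have hT2 : (√(P.θ c) ^ k) ^ 2 = P.θ c ^ k := by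
    rw [← pow_mul, mul_comm, pow_mul, Real.sq_sqrt hθ.le]
  have hR2 : √(4 * P.gap y0 ys / P.μφ) ^ 2 = 4 * P.gap y0 ys / P.μφ :=
    Real.sq_sqrt (by positivity)
  have hε1 : P.ε₁ c y0 ys ^ 2 =
      (√(P.θ c) - √(1 - 1 / √P.κφ)) ^ 2 * (P.μφ * P.gap y0 ys) := by
    rw [ε₁, mul_pow, Real.sq_sqrt (by positivity)]
  have hr0 : 0 ≤ √(1 - 1 / √P.κφ) := Real.sqrt_nonneg _
  unfold Problem.C at hk
  unfold εSq at hx'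
  rw [hε1] at hx'
  set q := √P.κφ with hq
  set r := √(1 - 1 / q) with hr
  set τ := √(P.θ c) with hτ
  set Δ := P.gap y0 ys
  set T := P.θ c ^ k with hT
  have hT0 : 0 ≤ T := by positivity
  rw [← hκ2] at hk
  set H := q * (2 + r) / (q + 1) with hH
  have hH1 : 1 ≤ H := by
    rw [hH, one_le_div (by linarith)]
    nlinarith
  have hC1 : 32 * P.σ ^ 2 * q ^ 2 * (2 + r) ^ 2 / (P.μx ^ 2 * P.μφ * (q + 1) ^ 2)
      = 32 * P.σ ^ 2 / (P.μx ^ 2 * P.μφ) * H ^ 2 := by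
    rw [hH]; field_simp
  rw [hC1] at hk
  have hy2 : ‖y k - ys‖ ^ 2 ≤ 4 * Δ / P.μφ * T := by
    calc ‖y k - ys‖ ^ 2 ≤ (√(4 * Δ / P.μφ) * τ ^ k) ^ 2 := by gcongr
      _ = _ := by rw [mul_pow, hR2, hT2]
  have hz2 : ‖z k - ys‖ ^ 2 ≤ H ^ 2 * (4 * Δ / P.μφ * T) := by
    calc ‖z k - ys‖ ^ 2 ≤ (H * (√(4 * Δ / P.μφ) * τ ^ k)) ^ 2 := by gcongr
      _ = _ := by rw [mul_pow, mul_pow, hR2, hT2]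
  have hB0 : 0 ≤ 2 * P.μφ / P.σ ^ 2 * (τ - r) ^ 2 * Δ * T := by positivity
  have hA0 : 0 ≤ P.σ ^ 2 / (P.μx ^ 2 * P.μφ) * H ^ 2 * Δ * T := by positivity
  refine ⟨?_, ?_⟩
  · have e1 : x (k + 1) - xs = (x (k + 1) - P.xStar (z k)) + (P.xStar (z k) - xs) := by abel
    have e2 : ‖x (k + 1) - xs‖ ^ 2 ≤
        2 * ‖x (k + 1) - P.xStar (z k)‖ ^ 2 + 2 * ‖P.xStar (z k) - xs‖ ^ 2 := by
      have := norm_add_le (x (k + 1) - P.xStar (z k)) (P.xStar (z k) - xs)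
      rw [← e1] at this
      have h3 := sq_nonneg (‖x (k + 1) - P.xStar (z k)‖ - ‖P.xStar (z k) - xs‖)
      have h4 : ‖x (k + 1) - xs‖ ^ 2 ≤
        (‖x (k + 1) - P.xStar (z k)‖ + ‖P.xStar (z k) - xs‖) ^ 2 := by gcongr
      linarith
    have e3 : ‖P.xStar (z k) - xs‖ ^ 2 ≤ (P.σ / P.μx) ^ 2 * (H ^ 2 * (4 * Δ / P.μφ * T)) := by
      calc ‖P.xStar (z k) - xs‖ ^ 2 ≤ (P.σ / P.μx * ‖z k - ys‖) ^ 2 := by gcongr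
        _ = (P.σ / P.μx) ^ 2 * ‖z k - ys‖ ^ 2 := mul_pow _ _ _
        _ ≤ _ := by gcongr
    have e4 : (P.σ / P.μx) ^ 2 * (H ^ 2 * (4 * Δ / P.μφ * T))
        = 4 * (P.σ ^ 2 / (P.μx ^ 2 * P.μφ) * H ^ 2 * Δ * T) := by field_simp
    have e5 : T * ((τ - r) ^ 2 * (P.μφ * Δ)) / P.σ ^ 2
        = (2 * P.μφ / P.σ ^ 2 * (τ - r) ^ 2 * Δ * T) / 2 := by field_simp
    have e6 : 32 * P.σ ^ 2 / (P.μx ^ 2 * P.μφ) * H ^ 2 * Δ * T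
        = 32 * (P.σ ^ 2 / (P.μx ^ 2 * P.μφ) * H ^ 2 * Δ * T) := by ring
    rw [add_mul, add_mul, e6] at hk
    linarith
  · refine hy2.trans ?_
    have e1 : 32 * P.σ ^ 2 / (P.μx ^ 2 * P.μφ) * H ^ 2 * Δ * T ≤ ε := by
      rw [add_mul, add_mul] at hk
      linarith
    calc 4 * Δ / P.μφ * T ≤ 32 * Δ / P.μφ * T * 1 ^ 2 := by
          rw [one_pow, mul_one]; gcongr; norm_num
      _ ≤ 32 * Δ / P.μφ * T * H ^ 2 := by gcongr
      _ = P.μx ^ 2 / P.σ ^ 2 * (32 * P.σ ^ 2 / (P.μx ^ 2 * P.μφ) * H ^ 2 * Δ * T) := by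
          field_simp
      _ ≤ _ := by gcongr

end Outer

lemma mul_θ_pow_le (h : P.Assumptions) {c : ℝ} (hc : 1 < c) {M ε : ℝ} (hM : 0 ≤ M) (hε : 0 < ε)
    {k : ℕ} (hk : c * √P.κφ * Real.log (M / ε) ≤ k) : M * P.θ c ^ k ≤ ε := by
  rcases hM.eq_or_lt with rfl | hM
  · simpa using hε.le
  have hq := h.sqrt_κφ_pos
  have hcq : 0 < c * √P.κφ := by positivity
  have h1 : P.θ c ≤ Real.exp (-(1 / (c * √P.κφ))) := by
    have := Real.add_one_le_exp (-(1 / (c * √P.κφ)))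
    unfold θ
    linarith
  have h2 : P.θ c ^ k ≤ Real.exp (-Real.log (M / ε)) := by
    calc P.θ c ^ k ≤ Real.exp (-(1 / (c * √P.κφ))) ^ k :=
          pow_le_pow_left₀ (h.θ_pos hc).le h1 k
      _ = Real.exp (-(k / (c * √P.κφ))) := by rw [← Real.exp_nat_mul]; congr 1; ring
      _ ≤ _ := by
          refine Real.exp_le_exp.2 (neg_le_neg ?_)
          rw [le_div_iff₀ hcq]
          linarith
  rw [Real.exp_neg, Real.exp_log (by positivity), inv_div] at h2
  calc M * P.θ c ^ k ≤ M * (ε / M) := by gcongr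
    _ = ε := by field_simp

end Assumptions

end Problem

/-! ### Linear convergence of the inner method -/

lemma apgParam_succ_sq (q : ℝ) (n : ℕ) :
    apgParam q (n + 1) ^ 2 =
      (1 - apgParam q (n + 1)) * apgParam q n ^ 2 + q * apgParam q (n + 1) := by
  have h1 : √((q - apgParam q n ^ 2) ^ 2 + 4 * apgParam q n ^ 2) ^ 2
      = (q - apgParam q n ^ 2) ^ 2 + 4 * apgParam q n ^ 2 := Real.sq_sqrt (by positivity)
  simp only [apgParam]
  nlinarith

lemma apgParam_pos (q : ℝ) (n : ℕ) : 0 < apgParam q n := by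
  induction n with
  | zero => simp [apgParam]
  | succ n ih =>
    have h1 : |q - apgParam q n ^ 2| < √((q - apgParam q n ^ 2) ^ 2 + 4 * apgParam q n ^ 2) := by
      refine Real.lt_sqrt_of_sq_lt ?_
      rw [sq_abs]
      have : 0 < 4 * apgParam q n ^ 2 := by positivity
      linarith
    have h2 := neg_abs_le (q - apgParam q n ^ 2)
    simp only [apgParam]
    linarith

lemma apgParam_le_one {q : ℝ} (hq1 : q ≤ 1) (n : ℕ) : apgParam q n ≤ 1 := by
  cases n with
  | zero => simp [apgParam]
  | succ n =>
    have h1 := apgParam_succ_sq q n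
    have h2 := apgParam_pos q n
    have h3 := apgParam_pos q (n + 1)
    by_contra! H
    nlinarith [mul_pos (sub_pos.2 H) (pow_pos h2 2), mul_pos (sub_pos.2 H) h3]

lemma sqrt_le_apgParam {q : ℝ} (hq1 : q ≤ 1) (n : ℕ) : √q ≤ apgParam q n := by
  induction n with
  | zero => simpa [apgParam, Real.sqrt_le_one] using hq1
  | succ n ih =>
    have h1 := apgParam_succ_sq q n
    have h2 : q ≤ apgParam q n ^ 2 := (Real.sqrt_le_left (apgParam_pos q n).le).1 ih
    refine Real.sqrt_le_iff.2 ⟨(apgParam_pos q (n + 1)).le, ?_⟩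
    have h3 := apgParam_le_one hq1 (n + 1)
    nlinarith [mul_nonneg (sub_nonneg.2 h3) (sub_nonneg.2 h2)]

section APG
variable {d : ℕ} {μ L : ℝ} {f : E d → ℝ} {G : E d → E d} {h : E d → EReal} {s : E d}

/-- The Lyapunov estimate for APG. The first step, with `t₀ = 1`, is a plain proximal gradient step;
it does not assume that the starting point `w` lies in the domain of `h`. -/
lemma apg_lyapunov (hμ : 0 < μ) (hμL : μ ≤ L) (hh : IsProperConvexLSC h)
    (hupper : ∀ z u, f u ≤ f z + inner ℝ (G z) (u - z) + L / 2 * ‖u - z‖ ^ 2)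
    (hlower : ∀ z u, f z + inner ℝ (G z) (u - z) + μ / 2 * ‖u - z‖ ^ 2 ≤ f u)
    (hs : h s ≠ ⊤) (w : E d) (n : ℕ) :
    h (apg G h μ L w (n + 1)).1 ≠ ⊤ ∧
    f (apg G h μ L w (n + 1)).1 + (h (apg G h μ L w (n + 1)).1).toReal - (f s + (h s).toReal)
      + L * apgParam (μ / L) n ^ 2 / 2 * ‖(apg G h μ L w n).1 + (1 / apgParam (μ / L) n) •
          ((apg G h μ L w (n + 1)).1 - (apg G h μ L w n).1) - s‖ ^ 2 ≤
      (1 - √(μ / L)) ^ n * ((L - μ) / 2 * ‖w - s‖ ^ 2) := by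
  have hL : 0 < L := hμ.trans_le hμL
  have hstep : ∀ n, h (apg G h μ L w (n + 1)).1 ≠ ⊤ ∧ ∀ u, h u ≠ ⊤ →
      f (apg G h μ L w (n + 1)).1 + (h (apg G h μ L w (n + 1)).1).toReal ≤
        f u + (h u).toReal
        + L * inner ℝ ((apg G h μ L w (n + 1)).1 - (apg G h μ L w n).2)
            (u - (apg G h μ L w (n + 1)).1)
        + L / 2 * ‖(apg G h μ L w (n + 1)).1 - (apg G h μ L w n).2‖ ^ 2
        + inner ℝ 0 (u - (apg G h μ L w (n + 1)).1)
        - μ / 2 * ‖u - (apg G h μ L w n).2‖ ^ 2 := fun n =>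
    prox_step hL hh (p := G (apg G h μ L w n).2) (e := 0) (by rw [add_zero]; rfl)
      (hupper _) (hlower _)
  have hq1 : μ / L ≤ 1 := (div_le_one hL).2 hμL
  induction n with
  | zero =>
    obtain ⟨h1, h2⟩ := hstep 0
    refine ⟨h1, ?_⟩
    have h3 := h2 s hs
    have h4 := inner_add_half_norm_sq L (apg G h μ L w 1).1 (apg G h μ L w 0).2 s
    have h5 : (apg G h μ L w 0).1 + (1 / apgParam (μ / L) 0) •
        ((apg G h μ L w (0 + 1)).1 - (apg G h μ L w 0).1) - s
        = (apg G h μ L w 1).1 - s := by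
      simp only [apgParam, zero_add, div_one, one_smul]
      abel
    have h6 : (apg G h μ L w 0).2 = w := rfl
    rw [h5]
    rw [h6] at h3 h4
    simp only [zero_add, inner_zero_left] at h3 ⊢
    rw [norm_sub_rev s w] at h3 h4
    rw [norm_sub_rev s] at h4
    simp only [apgParam, one_pow, pow_zero]
    linarith
  | succ n ih =>
    obtain ⟨h1, h2⟩ := hstep (n + 1)
    refine ⟨h1, ?_⟩
    have ht := apgParam_pos (μ / L) (n + 1)
    have ht0 := apgParam_pos (μ / L) n
    have ht1 := apgParam_le_one hq1 (n + 1)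
    have hrec := apgParam_succ_sq (μ / L) n
    have hsq := sqrt_le_apgParam hq1 (n + 1)
    have hU : (apg G h μ L w (n + 1)).2 = (apg G h μ L w (n + 1)).1 +
        (apgParam (μ / L) n * (1 - apgParam (μ / L) n) /
          (apgParam (μ / L) n ^ 2 + apgParam (μ / L) (n + 1))) •
        ((apg G h μ L w (n + 1)).1 - (apg G h μ L w n).1) := rfl
    have h3 := h2 _ ih.1
    have h4 := h2 s hs
    have h5 := ih.2
    set t := apgParam (μ / L) (n + 1)
    set t₀ := apgParam (μ / L) n
    set W₀ := (apg G h μ L w n).1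
    set W₁ := (apg G h μ L w (n + 1)).1
    set W₂ := (apg G h μ L w (n + 1 + 1)).1
    set U := (apg G h μ L w (n + 1)).2
    have hLt : L * t ^ 2 = (1 - t) * (L * t₀ ^ 2) + μ * t := by
      rw [hrec]; field_simp
    have hLt' : L * t₀ ^ 2 + t * μ = L * t * (t₀ ^ 2 + t) := by linarith
    have hu : (L * t₀ ^ 2 + t * μ) • U
        = (t * (L * t₀ ^ 2)) • (W₀ + (1 / t₀) • (W₁ - W₀)) + (L * t ^ 2) • W₁ := by
      have e1 : (L * t * (t₀ ^ 2 + t)) * (t₀ * (1 - t₀) / (t₀ ^ 2 + t)) = L * t * t₀ * (1 - t₀) := by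
        have : t₀ ^ 2 + t ≠ 0 := by positivity
        field_simp
      have e2 : t * (L * t₀ ^ 2) * (1 / t₀) = L * t * t₀ := by field_simp
      rw [hLt', hU, smul_add, smul_smul, e1, smul_add, smul_smul, e2]
      module
    have h6 := lyapunov_step (D := f W₁ + (h W₁).toReal - (f s + (h s).toReal))
      (D' := f W₂ + (h W₂).toReal - (f s + (h s).toReal)) (e := 0) (s := s) (y := W₂)
      hL hμ.le ht ht1 (by positivity) hLt hu (by linarith) (by linarith)
    rw [inner_zero_left, mul_zero, add_zero] at h6
    have h7 : 0 ≤ (1 - √(μ / L)) ^ n * ((L - μ) / 2 * ‖w - s‖ ^ 2) := by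
      have : √(μ / L) ≤ 1 := Real.sqrt_le_one.2 hq1
      have : 0 ≤ L - μ := by linarith
      have : 0 ≤ 1 - √(μ / L) := by linarith
      positivity
    calc _ ≤ _ := h6
      _ ≤ (1 - t) * ((1 - √(μ / L)) ^ n * ((L - μ) / 2 * ‖w - s‖ ^ 2)) :=
          mul_le_mul_of_nonneg_left h5 (by linarith)
      _ ≤ (1 - √(μ / L)) * ((1 - √(μ / L)) ^ n * ((L - μ) / 2 * ‖w - s‖ ^ 2)) := by gcongr
      _ = _ := by rw [pow_succ]; ring

lemma apg_norm_sq_le (hμ : 0 < μ) (hμL : μ ≤ L) (hh : IsProperConvexLSC h)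
    (hupper : ∀ z u, f u ≤ f z + inner ℝ (G z) (u - z) + L / 2 * ‖u - z‖ ^ 2)
    (hlower : ∀ z u, f z + inner ℝ (G z) (u - z) + μ / 2 * ‖u - z‖ ^ 2 ≤ f u)
    (hs : h s ≠ ⊤) (hmin : ∀ u, h u ≠ ⊤ →
      f s + (h s).toReal + μ / 2 * ‖u - s‖ ^ 2 ≤ f u + (h u).toReal) (w : E d) (n : ℕ) :
    ‖(apg G h μ L w (n + 1)).1 - s‖ ^ 2 ≤
      (1 - √(μ / L)) ^ n * ((L / μ - 1) * ‖w - s‖ ^ 2) := by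
  obtain ⟨h1, h2⟩ := apg_lyapunov hμ hμL hh hupper hlower hs w n
  have h3 := hmin _ h1
  have h4 : ∀ x : ℝ, 0 ≤ L * apgParam (μ / L) n ^ 2 / 2 * x ^ 2 := fun x => by
    have hL : 0 < L := hμ.trans_le hμL
    positivity
  have h5 : μ / 2 * ((1 - √(μ / L)) ^ n * ((L / μ - 1) * ‖w - s‖ ^ 2))
      = (1 - √(μ / L)) ^ n * ((L - μ) / 2 * ‖w - s‖ ^ 2) := by
    field_simp
  refine le_of_mul_le_mul_left (a := μ / 2) ?_ (by positivity)
  rw [h5]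
  exact le_trans (by linarith [h4 ‖(apg G h μ L w n).1 + (1 / apgParam (μ / L) n) •
    ((apg G h μ L w (n + 1)).1 - (apg G h μ L w n).1) - s‖]) h2

/-- The number of APG steps that suffice for the accuracy `δ`. -/
lemma exists_apg_norm_sq_le (hμ : 0 < μ) (hμL : μ ≤ L) (hh : IsProperConvexLSC h)
    (hupper : ∀ z u, f u ≤ f z + inner ℝ (G z) (u - z) + L / 2 * ‖u - z‖ ^ 2)
    (hlower : ∀ z u, f z + inner ℝ (G z) (u - z) + μ / 2 * ‖u - z‖ ^ 2 ≤ f u)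
    (hs : h s ≠ ⊤) (hmin : ∀ u, h u ≠ ⊤ →
      f s + (h s).toReal + μ / 2 * ‖u - s‖ ^ 2 ≤ f u + (h u).toReal) (w : E d)
    {δ : ℝ} (hδ : 0 < δ) :
    ∃ n : ℕ, (n : ℝ) ≤ 2 + √(L / μ) * Real.log (1 + L / μ * ‖w - s‖ ^ 2 / δ) ∧
      ‖(apg G h μ L w n).1 - s‖ ^ 2 ≤ δ := by
  have hL : 0 < L := hμ.trans_le hμL
  have hκ : 0 < √(L / μ) := Real.sqrt_pos.2 (by positivity)
  set X := 1 + L / μ * ‖w - s‖ ^ 2 / δ with hX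
  have hX1 : 1 ≤ X := by
    have : 0 ≤ L / μ * ‖w - s‖ ^ 2 / δ := by positivity
    linarith
  have hlog : 0 ≤ Real.log X := Real.log_nonneg hX1
  set m := ⌈√(L / μ) * Real.log X⌉₊ with hm
  refine ⟨m + 1, ?_, ?_⟩
  · have := Nat.ceil_lt_add_one (mul_nonneg hκ.le hlog)
    push_cast
    linarith
  · have h1 := apg_norm_sq_le hμ hμL hh hupper hlower hs hmin w m
    have hq : √(μ / L) = 1 / √(L / μ) := by
      rw [← inv_div, Real.sqrt_inv, one_div]
    have h2 : (1 - √(μ / L)) ^ m ≤ 1 / X := by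
      have e1 : 0 ≤ 1 - √(μ / L) := by
        have : √(μ / L) ≤ 1 := Real.sqrt_le_one.2 ((div_le_one hL).2 hμL)
        linarith
      calc (1 - √(μ / L)) ^ m ≤ Real.exp (-√(μ / L)) ^ m := by
            gcongr
            have := Real.add_one_le_exp (-√(μ / L))
            linarith
        _ = Real.exp (-(m / √(L / μ))) := by
            rw [← Real.exp_nat_mul, hq]; congr 1; ring
        _ ≤ Real.exp (-Real.log X) := by
            refine Real.exp_le_exp.2 (neg_le_neg ?_)
            rw [le_div_iff₀ hκ, mul_comm]
            exact Nat.le_ceil _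
        _ = 1 / X := by rw [Real.exp_neg, Real.exp_log (by linarith), one_div]
    have h3 : 0 ≤ (L / μ - 1) * ‖w - s‖ ^ 2 := by
      have : 1 ≤ L / μ := (one_le_div hμ).2 hμL
      exact mul_nonneg (by linarith) (by positivity)
    have h4 : (L / μ - 1) * ‖w - s‖ ^ 2 ≤ δ * X := by
      have : δ * X = δ + L / μ * ‖w - s‖ ^ 2 := by rw [hX]; field_simp
      nlinarith [sq_nonneg ‖w - s‖]
    calc _ ≤ _ := h1
      _ ≤ 1 / X * ((L / μ - 1) * ‖w - s‖ ^ 2) := by gcongr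
      _ ≤ 1 / X * (δ * X) := by gcongr
      _ = δ := by field_simp

end APG

namespace Problem
variable {dx dy : ℕ} {P : Problem dx dy}

namespace Assumptions

lemma subproblem_upper (h : P.Assumptions) (y : E dy) (z u : E dx) :
    P.f₁ u + inner ℝ (P.Bt y) u ≤ P.f₁ z + inner ℝ (P.Bt y) z
      + inner ℝ (gradient P.f₁ z + P.Bt y) (u - z) + P.Lx / 2 * ‖u - z‖ ^ 2 := by
  have h1 := h.f₁_smooth.le_quadratic z u
  rw [inner_add_left, inner_sub_right (P.Bt y)]
  linarith

lemma subproblem_lower (h : P.Assumptions) (y : E dy) (z u : E dx) :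
    P.f₁ z + inner ℝ (P.Bt y) z + inner ℝ (gradient P.f₁ z + P.Bt y) (u - z)
      + P.μx / 2 * ‖u - z‖ ^ 2 ≤ P.f₁ u + inner ℝ (P.Bt y) u := by
  have hconv : ConvexOn ℝ Set.univ P.f₁ :=
    strongConvexOn_zero.1 (h.f₁_strong.mono h.μx_pos.le)
  have h1 := StrongConvexOn.quadratic_le h.f₁_strong (h.f₁_smooth.subgradient hconv z) u
  rw [inner_add_left, inner_sub_right (P.Bt y)]
  linarith

lemma ε₁_pos (h : P.Assumptions) {c : ℝ} (hc : 1 < c) {y0 ys : E dy} (hΔ : 0 < P.gap y0 ys) :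
    0 < P.ε₁ c y0 ys :=
  mul_pos (sub_pos.2 (h.sqrt_lt_sqrt_θ hc)) (Real.sqrt_pos.2 (mul_pos h.μφ_pos hΔ))

lemma εSq_pos (h : P.Assumptions) {c : ℝ} (hc : 1 < c) {y0 ys : E dy} (hΔ : 0 < P.gap y0 ys)
    (k : ℕ) : 0 < P.εSq c y0 ys k :=
  mul_pos (pow_pos (h.θ_pos hc) k) (pow_pos (h.ε₁_pos hc hΔ) 2)

lemma exists_accurate (h : P.Assumptions) {c : ℝ} (hc : 1 < c) {y0 ys : E dy}
    (hΔ : 0 < P.gap y0 ys) (k : ℕ) (z : E dy) (w : E dx) :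
    ∃ n : ℕ, (n : ℝ) ≤ 2 + √P.κx *
        Real.log (1 + P.κx * ‖w - P.xStar z‖ ^ 2 / (P.εSq c y0 ys k / P.σ ^ 2)) ∧
      P.Accurate c y0 ys k z (P.subApg z w n) :=
  exists_apg_norm_sq_le (f := fun x => P.f₁ x + inner ℝ (P.Bt z) x) h.μx_pos h.μx_le_Lx h.f₂_pcl
    (h.subproblem_upper z) (h.subproblem_lower z) (h.xStar_spec z).1 (h.xStar_spec z).2 w
    (div_pos (h.εSq_pos hc hΔ k) (pow_pos h.σ_pos 2))

lemma accurate_innerCount (h : P.Assumptions) {c : ℝ} (hc : 1 < c) {y0 ys : E dy}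
    (hΔ : 0 < P.gap y0 ys) (k : ℕ) (z : E dy) (w : E dx) :
    P.Accurate c y0 ys k z (P.subApg z w (P.innerCount c y0 ys k z w)) := by
  obtain ⟨n, -, hn⟩ := h.exists_accurate hc hΔ k z w
  exact Nat.sInf_mem (s := {n : ℕ | P.Accurate c y0 ys k z (P.subApg z w n)}) ⟨n, hn⟩

lemma innerCount_le (h : P.Assumptions) {c : ℝ} (hc : 1 < c) {y0 ys : E dy}
    (hΔ : 0 < P.gap y0 ys) (k : ℕ) (z : E dy) (w : E dx) :
    (P.innerCount c y0 ys k z w : ℝ) ≤ 2 + √P.κx *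
      Real.log (1 + P.κx * ‖w - P.xStar z‖ ^ 2 / (P.εSq c y0 ys k / P.σ ^ 2)) := by
  obtain ⟨n, hn, hacc⟩ := h.exists_accurate hc hΔ k z w
  refine le_trans ?_ hn
  exact_mod_cast Nat.sInf_le (s := {n : ℕ | P.Accurate c y0 ys k z (P.subApg z w n)}) hacc

/-! ### The total number of inner iterations -/

lemma isIDAPG_run (P : Problem dx dy) (c : ℝ) (ys : E dy) (x0 : E dx) (y0 : E dy) :
    P.IsIDAPG (P.runX c ys x0 y0) (P.runY c ys x0 y0) (P.runZ c ys x0 y0) :=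
  ⟨rfl, fun _ => rfl, fun _ => rfl⟩

lemma accurate_run (h : P.Assumptions) {c : ℝ} (hc : 1 < c) {y0 ys : E dy}
    (hΔ : 0 < P.gap y0 ys) (x0 : E dx) (k : ℕ) :
    P.Accurate c y0 ys k (P.runZ c ys x0 y0 k) (P.runX c ys x0 y0 (k + 1)) :=
  h.accurate_innerCount hc hΔ k _ _

/-- Under a warm start, the initial error of every subproblem but the first exceeds the required
accuracy by a factor polynomial in `κ_φ` only. -/
lemma warm_start (h : P.Assumptions) {c : ℝ} (hc : 1 < c) {xs : E dx} {ys y0 : E dy}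
    (hs : P.IsSaddle xs ys) {x : ℕ → E dx} {y z : ℕ → E dy} (hit : P.IsIDAPG x y z)
    (hy : y 0 = y0) (hy0 : P.g₂ y0 ≠ ⊤) (hΔ : 0 < P.gap y0 ys)
    (hacc : ∀ k, P.Accurate c y0 ys k (z k) (x (k + 1))) (k : ℕ) :
    ‖x (k + 1) - P.xStar (z (k + 1))‖ ^ 2 / (P.εSq c y0 ys (k + 1) / P.σ ^ 2) ≤
      1154 / (1 - 1 / c) ^ 3 * P.κφ ^ 3 := by
  have hz1 := h.norm_z_sub_le hc hs hit hy hy0 hacc (k + 1)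
  have hz0 := h.norm_z_sub_le hc hs hit hy hy0 hacc k
  have hx' := hacc k
  unfold Accurate at hx'
  have hlip := h.xStar_lipschitz (z k) (z (k + 1))
  have hσ := h.σ_pos
  have hμx := h.μx_pos
  have hμφ := h.μφ_pos
  have hθ := h.θ_pos hc
  have hθ1 := h.θ_le_one hc
  have hbθ := h.one_sub_inv_le_θ hc
  have hb := one_sub_inv_pos hc
  have hκ := h.one_le_κφ
  have h1 := h.one_le_sqrt_κφ
  have hκ2 : √P.κφ ^ 2 = P.κφ := Real.sq_sqrt (by linarith)
  have hm := h.le_sqrt_θ_sub hc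
  have hε1 : P.ε₁ c y0 ys ^ 2 =
      (√(P.θ c) - √(1 - 1 / √P.κφ)) ^ 2 * (P.μφ * P.gap y0 ys) := by
    rw [ε₁, mul_pow, Real.sq_sqrt (by positivity)]
  have hT2 : (√(P.θ c) ^ k) ^ 2 = P.θ c ^ k := by
    rw [← pow_mul, mul_comm, pow_mul, Real.sq_sqrt hθ.le]
  have hR2 : √(4 * P.gap y0 ys / P.μφ) ^ 2 = 4 * P.gap y0 ys / P.μφ :=
    Real.sq_sqrt (by positivity)
  have hσκ : P.σ ^ 2 / (P.μx * P.μφ) ≤ P.κφ := by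
    unfold κφ
    have := mul_nonneg hμx.le h.Ly_nonneg
    gcongr
    linarith
  have hr0 : 0 ≤ √(1 - 1 / √P.κφ) := Real.sqrt_nonneg _
  have hr1 : √(1 - 1 / √P.κφ) ≤ 1 := by
    refine Real.sqrt_le_one.2 ?_
    have : 0 < 1 / √P.κφ := by positivity
    linarith
  have hH : √P.κφ * (2 + √(1 - 1 / √P.κφ)) / (√P.κφ + 1) ≤ 3 := by
    rw [div_le_iff₀ (by positivity)]
    nlinarith
  unfold εSq at hx' ⊢
  set H := √P.κφ * (2 + √(1 - 1 / √P.κφ)) / (√P.κφ + 1)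
  set R := √(4 * P.gap y0 ys / P.μφ)
  have hR : 0 ≤ R := Real.sqrt_nonneg _
  set τ := √(P.θ c)
  have hτ0 : 0 ≤ τ := Real.sqrt_nonneg _
  have hτ1 : τ ≤ 1 := Real.sqrt_le_one.2 hθ1
  set m := τ - √(1 - 1 / √P.κφ)
  set Δ := P.gap y0 ys
  set b := 1 - 1 / c with hbdef
  have hb1 : b ≤ 1 := by
    have : 0 < 1 / c := by positivity
    linarith
  have hm0 : 0 < m := lt_of_lt_of_le (by positivity) hm
  have hm2 : b ^ 2 / (4 * P.κφ) ≤ m ^ 2 := by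
    calc b ^ 2 / (4 * P.κφ) = (b / (2 * √P.κφ)) ^ 2 := by
          rw [div_pow, mul_pow, hκ2]; norm_num
      _ ≤ m ^ 2 := by gcongr
  -- consecutive extrapolated points are within `6 R √θᵏ` of each other
  have hz : ‖z k - z (k + 1)‖ ≤ 6 * R * τ ^ k := by
    have e1 : z k - z (k + 1) = (z k - ys) - (z (k + 1) - ys) := by abel
    calc ‖z k - z (k + 1)‖ ≤ ‖z k - ys‖ + ‖z (k + 1) - ys‖ := by rw [e1]; exact norm_sub_le _ _
      _ ≤ H * (R * τ ^ k) + H * (R * τ ^ (k + 1)) := add_le_add hz0 hz1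
      _ ≤ 3 * (R * τ ^ k) + 3 * (R * τ ^ k) := by
          gcongr ?_ * _ + ?_ * (_ * ?_)
          exact pow_le_pow_of_le_one hτ0 hτ1 (Nat.le_succ k)
      _ = _ := by ring
  set T := P.θ c ^ k with hT
  have hT0 : 0 < T := by positivity
  have hz2 : ‖z k - z (k + 1)‖ ^ 2 ≤ 144 * Δ / P.μφ * T := by
    calc ‖z k - z (k + 1)‖ ^ 2 ≤ (6 * R * τ ^ k) ^ 2 := by gcongr
      _ = _ := by rw [mul_pow, mul_pow, hR2, hT2]; ring
  have hD : ‖x (k + 1) - P.xStar (z (k + 1))‖ ^ 2 ≤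
      2 * (T * P.ε₁ c y0 ys ^ 2 / P.σ ^ 2)
        + 2 * ((P.σ / P.μx) ^ 2 * (144 * Δ / P.μφ * T)) := by
    have e1 : x (k + 1) - P.xStar (z (k + 1))
        = (x (k + 1) - P.xStar (z k)) + (P.xStar (z k) - P.xStar (z (k + 1))) := by abel
    have e2 := norm_add_le (x (k + 1) - P.xStar (z k)) (P.xStar (z k) - P.xStar (z (k + 1)))
    rw [← e1] at e2
    have e3 : ‖P.xStar (z k) - P.xStar (z (k + 1))‖ ^ 2 ≤
        (P.σ / P.μx) ^ 2 * (144 * Δ / P.μφ * T) := by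
      calc ‖P.xStar (z k) - P.xStar (z (k + 1))‖ ^ 2
          ≤ (P.σ / P.μx * ‖z k - z (k + 1)‖) ^ 2 := by gcongr
        _ = (P.σ / P.μx) ^ 2 * ‖z k - z (k + 1)‖ ^ 2 := mul_pow _ _ _
        _ ≤ _ := by gcongr
    have e4 := sq_nonneg (‖x (k + 1) - P.xStar (z k)‖ - ‖P.xStar (z k) - P.xStar (z (k + 1))‖)
    have e5 : ‖x (k + 1) - P.xStar (z (k + 1))‖ ^ 2 ≤
        (‖x (k + 1) - P.xStar (z k)‖ + ‖P.xStar (z k) - P.xStar (z (k + 1))‖) ^ 2 := by gcongr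
    linarith
  have hεpos : 0 < P.ε₁ c y0 ys ^ 2 := pow_pos (h.ε₁_pos hc hΔ) 2
  calc _ ≤ (2 * (T * P.ε₁ c y0 ys ^ 2 / P.σ ^ 2)
        + 2 * ((P.σ / P.μx) ^ 2 * (144 * Δ / P.μφ * T)))
          / (P.θ c ^ (k + 1) * P.ε₁ c y0 ys ^ 2 / P.σ ^ 2) := by gcongr
    _ = 2 / P.θ c + 288 * (P.σ ^ 2 / (P.μx * P.μφ)) ^ 2 / (P.θ c * m ^ 2) := by
        rw [pow_succ (P.θ c) k, ← hT, hε1]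
        field_simp
        ring
    _ ≤ 2 / b + 288 * P.κφ ^ 2 / (b * (b ^ 2 / (4 * P.κφ))) := by gcongr
    _ = 2 / b + 1152 / b ^ 3 * P.κφ ^ 3 := by field_simp; ring
    _ ≤ 2 / b ^ 3 * P.κφ ^ 3 + 1152 / b ^ 3 * P.κφ ^ 3 := by
        gcongr
        have e1 : b ^ 3 ≤ b := by
          calc b ^ 3 ≤ b ^ 1 := pow_le_pow_of_le_one hb.le hb1 (by norm_num)
            _ = b := pow_one b
        have e2 : 1 ≤ P.κφ ^ 3 := one_le_pow₀ hκ
        calc 2 / b ≤ 2 / b ^ 3 := by gcongr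
          _ ≤ 2 / b ^ 3 * P.κφ ^ 3 := le_mul_of_one_le_right (by positivity) e2
    _ = _ := by ring

/-- The number of inner iterations spent on a warm-started subproblem. -/
lemma innerCount_succ_le (h : P.Assumptions) {c : ℝ} (hc : 1 < c) {xs : E dx} {ys y0 : E dy}
    (hs : P.IsSaddle xs ys) (hy0 : P.g₂ y0 ≠ ⊤) (hΔ : 0 < P.gap y0 ys) (x0 : E dx) (k : ℕ) :
    (P.innerCount c y0 ys (k + 1) (P.runZ c ys x0 y0 (k + 1)) (P.runX c ys x0 y0 (k + 1)) : ℝ) ≤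
      2 + √P.κx * (Real.log (1155 / (1 - 1 / c) ^ 3) + 3 * Real.log (P.κφ * P.κx)) := by
  have hw := h.warm_start (y0 := y0) hc hs (isIDAPG_run P c ys x0 y0) rfl hy0 hΔ
    (h.accurate_run hc hΔ x0) k
  have hκφ := h.one_le_κφ
  have hκx := h.one_le_κx
  have hb := one_sub_inv_pos hc
  have hb1 : 1 - 1 / c ≤ 1 := by
    have : 0 < 1 / c := by positivity
    linarith
  set b := 1 - 1 / c
  refine (h.innerCount_le hc hΔ (k + 1) _ _).trans ?_
  rw [mul_div_assoc]
  have hpos := div_pos (h.εSq_pos hc hΔ (k + 1)) (pow_pos h.σ_pos 2)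
  set r := ‖P.runX c ys x0 y0 (k + 1) - P.xStar (P.runZ c ys x0 y0 (k + 1))‖ ^ 2 /
    (P.εSq c y0 ys (k + 1) / P.σ ^ 2)
  have hr0 : 0 ≤ r := by positivity
  have hle : 1 + P.κx * r ≤ 1155 / b ^ 3 * (P.κφ * P.κx) ^ 3 := by
    have e1 : 1 ≤ 1 / b ^ 3 * (P.κφ * P.κx) ^ 3 := by
      have e2 : 1 ≤ 1 / b ^ 3 := one_le_one_div (by positivity) (pow_le_one₀ hb.le hb1)
      have e3 : 1 ≤ (P.κφ * P.κx) ^ 3 := one_le_pow₀ (one_le_mul_of_one_le_of_one_le hκφ hκx)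
      exact one_le_mul_of_one_le_of_one_le e2 e3
    have e4 : P.κx * r ≤ P.κx ^ 3 * (1154 / b ^ 3 * P.κφ ^ 3) := by
      have : P.κx ≤ P.κx ^ 3 := le_self_pow₀ hκx (by norm_num)
      gcongr
    calc 1 + P.κx * r
        ≤ 1 / b ^ 3 * (P.κφ * P.κx) ^ 3 + P.κx ^ 3 * (1154 / b ^ 3 * P.κφ ^ 3) := add_le_add e1 e4
      _ = _ := by ring
  have hlog : Real.log (1 + P.κx * r) ≤
      Real.log (1155 / b ^ 3) + 3 * Real.log (P.κφ * P.κx) := by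
    refine (Real.log_le_log (by positivity) hle).trans (le_of_eq ?_)
    rw [Real.log_mul (by positivity) (by positivity), Real.log_pow]
    norm_num
  gcongr

lemma log_warm_start_nonneg {c : ℝ} (hc : 1 < c) : 0 ≤ Real.log (1155 / (1 - 1 / c) ^ 3) := by
  have hb := one_sub_inv_pos hc
  have hb1 : 1 - 1 / c ≤ 1 := by
    have : 0 < 1 / c := by positivity
    linarith
  refine Real.log_nonneg ?_
  rw [one_le_div (by positivity)]
  linarith [pow_le_one₀ (n := 3) hb.le hb1]

/-- The first subproblem starts at the arbitrary point `x0`, which contributes the last logarithm;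
the other `K` subproblems are warm-started. -/
lemma totalInner_le (h : P.Assumptions) {c : ℝ} (hc : 1 < c) {xs : E dx} {ys y0 : E dy}
    (hs : P.IsSaddle xs ys) (hy0 : P.g₂ y0 ≠ ⊤) (hΔ : 0 < P.gap y0 ys) (x0 : E dx) (K : ℕ) :
    (P.totalInner c ys x0 y0 K : ℝ) ≤ √P.κx *
      ((5 + Real.log (1155 / (1 - 1 / c) ^ 3)) * (1 + Real.log (P.κφ * P.κx)) * (K + 1)
        + Real.log (1 + P.κx * P.σ ^ 2 * ‖x0 - P.xStar y0‖ ^ 2 / P.ε₁ c y0 ys ^ 2)) := by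
  have hκφ := h.one_le_κφ
  have hκx := h.one_le_κx
  have hσ := h.σ_pos
  have hε := h.ε₁_pos hc hΔ
  have hl : 0 ≤ Real.log (P.κφ * P.κx) :=
    Real.log_nonneg (one_le_mul_of_one_le_of_one_le hκφ hκx)
  have hG : 0 ≤ Real.log (1155 / (1 - 1 / c) ^ 3) := log_warm_start_nonneg hc
  have hk1 : 1 ≤ √P.κx := Real.one_le_sqrt.2 hκx
  have h0 := h.innerCount_le hc hΔ 0 y0 x0
  have e0 : P.κx * ‖x0 - P.xStar y0‖ ^ 2 / (P.εSq c y0 ys 0 / P.σ ^ 2)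
      = P.κx * P.σ ^ 2 * ‖x0 - P.xStar y0‖ ^ 2 / P.ε₁ c y0 ys ^ 2 := by
    unfold εSq
    rw [pow_zero, one_mul]
    field_simp
  rw [e0] at h0
  unfold totalInner
  rw [Finset.sum_range_succ']
  push_cast
  set G := Real.log (1155 / (1 - 1 / c) ^ 3)
  set l := Real.log (P.κφ * P.κx)
  set M := Real.log (1 + P.κx * P.σ ^ 2 * ‖x0 - P.xStar y0‖ ^ 2 / P.ε₁ c y0 ys ^ 2)
  have hsum : ∑ k ∈ Finset.range K, (P.innerCount c y0 ys (k + 1)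
      (P.runZ c ys x0 y0 (k + 1)) (P.runX c ys x0 y0 (k + 1)) : ℝ) ≤
      K * (2 + √P.κx * (G + 3 * l)) := by
    refine (Finset.sum_le_sum fun k _ => h.innerCount_succ_le hc hs hy0 hΔ x0 k).trans ?_
    rw [Finset.sum_const, Finset.card_range, nsmul_eq_mul]
  have hK : (0 : ℝ) ≤ K := Nat.cast_nonneg K
  have hstep : 2 + √P.κx * (G + 3 * l) ≤ √P.κx * ((5 + G) * (1 + l)) := by
    have : 2 + √P.κx * (G + 3 * l) ≤ √P.κx * (2 + (G + 3 * l)) := by linarith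
    refine this.trans (mul_le_mul_of_nonneg_left ?_ (by linarith))
    nlinarith [mul_nonneg hG hl]
  have hfirst : 2 ≤ √P.κx * ((5 + G) * (1 + l)) := by
    refine le_trans ?_ hstep
    have : 0 ≤ √P.κx * (G + 3 * l) := by positivity
    linarith
  calc _ ≤ K * (2 + √P.κx * (G + 3 * l)) + (2 + √P.κx * M) := add_le_add hsum h0
    _ ≤ K * (√P.κx * ((5 + G) * (1 + l))) + (√P.κx * ((5 + G) * (1 + l)) + √P.κx * M) := by
        gcongr
    _ = _ := by ring

end Assumptions

end Problem

end IDAPG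

theorem theorem3 (c : ℝ) (hc : 1 < c) :
    -- the constant `A` of the `O`-notation depends on `c` only
    ∃ A : ℝ, 0 < A ∧
      ∀ (dx dy : ℕ) (P : IDAPG.Problem dx dy), P.Assumptions →
      ∀ (xs : IDAPG.E dx) (ys : IDAPG.E dy), P.IsSaddle xs ys →
      ∀ y0 : IDAPG.E dy, P.g₂ y0 ≠ ⊤ →
        -- outer iteration complexity, for any way of solving the subproblems accurately enough
        (∀ (x : ℕ → IDAPG.E dx) (y z : ℕ → IDAPG.E dy),
          P.IsIDAPG x y z → y 0 = y0 →
          (∀ k, P.Accurate c y0 ys k (z k) (x (k + 1))) →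
          ∀ ε : ℝ, 0 < ε → ∀ k : ℕ,
            A * (√P.κφ * Real.log (P.C c * P.gap y0 ys / ε)) ≤ k →
            P.Reached xs ys ε x y k) ∧
        -- inner iteration complexity, with the subproblems solved by warm-started APG
        (0 < P.gap y0 ys → ∀ x0 : IDAPG.E dx,
          -- every call of APG attains the required accuracy after finitely many iterations
          P.IsIDAPG (P.runX c ys x0 y0) (P.runY c ys x0 y0) (P.runZ c ys x0 y0) ∧
          (∀ k, P.Accurate c y0 ys k (P.runZ c ys x0 y0 k) (P.runX c ys x0 y0 (k + 1))) ∧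
          -- bound for every `ε`, with the contribution of the initial point `x0`
          (∀ ε : ℝ, 0 < ε → ∃ K : ℕ,
            (∀ k, K ≤ k → P.Reached xs ys ε (P.runX c ys x0 y0) (P.runY c ys x0 y0) k) ∧
            (P.totalInner c ys x0 y0 K : ℝ) ≤
              A * √P.κx *
                ((1 + Real.log (P.κφ * P.κx)) *
                    (√P.κφ * max (Real.log (P.C c * P.gap y0 ys / ε)) 0 + 1)
                  + Real.log (1 + P.κx * P.σ ^ 2 * ‖x0 - P.xStar y0‖ ^ 2 / P.ε₁ c y0 ys ^ 2))) ∧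
          -- bound for all small `ε`
          (∃ ε₀ : ℝ, 0 < ε₀ ∧ ∀ ε : ℝ, 0 < ε → ε < ε₀ → ∃ K : ℕ,
            (∀ k, K ≤ k → P.Reached xs ys ε (P.runX c ys x0 y0) (P.runY c ys x0 y0) k) ∧
            (P.totalInner c ys x0 y0 K : ℝ) ≤
              A * (1 + Real.log (P.κφ * P.κx)) *
                (√(P.κφ * P.κx) * Real.log (P.C c * P.gap y0 ys / ε)))) := by
  have hG : 0 ≤ Real.log (1155 / (1 - 1 / c) ^ 3) :=
    IDAPG.Problem.Assumptions.log_warm_start_nonneg hc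
  -- `A'` is the constant of the bound for every `ε`; for small `ε` its three summands are merged
  obtain ⟨A', hA'⟩ : ∃ A', A' = (5 + Real.log (1155 / (1 - 1 / c) ^ 3)) * (c + 2) := ⟨_, rfl⟩
  have hcA : c ≤ A' := by rw [hA']; nlinarith
  have hA0 : 0 < A' := by linarith
  have hA1 : 1 ≤ A' := by linarith
  refine ⟨3 * A', by positivity, fun dx dy P h xs ys hs y0 hy0 => ?_⟩
  have hgap := h.gap_nonneg hs hy0
  have hC := h.C_pos hc
  have hq := h.one_le_sqrt_κφ
  have houter : ∀ (x : ℕ → IDAPG.E dx) (y z : ℕ → IDAPG.E dy),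
      P.IsIDAPG x y z → y 0 = y0 → (∀ k, P.Accurate c y0 ys k (z k) (x (k + 1))) →
      ∀ ε : ℝ, 0 < ε → ∀ k : ℕ, c * √P.κφ * Real.log (P.C c * P.gap y0 ys / ε) ≤ k →
        P.Reached xs ys ε x y k := fun x y z hit hy hacc ε hε k hk =>
    h.reached_of_le hc hs hit hy hy0 hacc (h.mul_θ_pow_le hc (by positivity) hε hk)
  refine ⟨fun x y z hit hy hacc ε hε k hk => houter x y z hit hy hacc ε hε k ?_,
    fun hΔ x0 => ?_⟩
  · rcases le_total 0 (Real.log (P.C c * P.gap y0 ys / ε)) with hlog | hlog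
    · refine le_trans ?_ hk
      rw [mul_assoc]
      gcongr
      linarith
    · have : c * √P.κφ * Real.log (P.C c * P.gap y0 ys / ε) ≤ 0 :=
        mul_nonpos_of_nonneg_of_nonpos (by positivity) hlog
      exact this.trans (Nat.cast_nonneg k)
  have hit := IDAPG.Problem.Assumptions.isIDAPG_run P c ys x0 y0
  have hacc := h.accurate_run hc hΔ x0
  have hl : 0 ≤ Real.log (P.κφ * P.κx) :=
    Real.log_nonneg (one_le_mul_of_one_le_of_one_le h.one_le_κφ h.one_le_κx)
  have hM : 0 ≤ Real.log (1 + P.κx * P.σ ^ 2 * ‖x0 - P.xStar y0‖ ^ 2 / P.ε₁ c y0 ys ^ 2) := by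
    refine Real.log_nonneg (le_add_of_nonneg_right ?_)
    have := h.one_le_κx
    positivity
  have htotal : ∀ ε : ℝ, 0 < ε → ∃ K : ℕ,
      (∀ k, K ≤ k → P.Reached xs ys ε (P.runX c ys x0 y0) (P.runY c ys x0 y0) k) ∧
      (P.totalInner c ys x0 y0 K : ℝ) ≤ A' * √P.κx *
        ((1 + Real.log (P.κφ * P.κx)) *
            (√P.κφ * max (Real.log (P.C c * P.gap y0 ys / ε)) 0 + 1)
          + Real.log (1 + P.κx * P.σ ^ 2 * ‖x0 - P.xStar y0‖ ^ 2 / P.ε₁ c y0 ys ^ 2)) := by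
    intro ε hε
    have hmax : 0 ≤ max (Real.log (P.C c * P.gap y0 ys / ε)) 0 := le_max_right _ _
    have hle : Real.log (P.C c * P.gap y0 ys / ε) ≤
      max (Real.log (P.C c * P.gap y0 ys / ε)) 0 := le_max_left _ _
    have htot := h.totalInner_le hc hs hy0 hΔ x0
    set m := max (Real.log (P.C c * P.gap y0 ys / ε)) 0
    refine ⟨⌈c * √P.κφ * m⌉₊, fun k hk => houter _ _ _ hit rfl hacc ε hε k ?_,
      (htot _).trans ?_⟩
    · have h1 : c * √P.κφ * m ≤ k := (Nat.le_ceil _).trans (by exact_mod_cast hk)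
      exact le_trans (by gcongr) h1
    · have hK := Nat.ceil_lt_add_one (a := c * √P.κφ * m) (by positivity)
      set K : ℝ := (⌈c * √P.κφ * m⌉₊ : ℝ)
      have hqm : 0 ≤ √P.κφ * m := by positivity
      have hK' : K + 1 ≤ (c + 2) * (√P.κφ * m + 1) := by nlinarith
      rw [mul_comm A', mul_assoc (√P.κx) A', mul_add A']
      refine mul_le_mul_of_nonneg_left (add_le_add ?_ ?_) (Real.sqrt_nonneg _)
      · calc (5 + Real.log (1155 / (1 - 1 / c) ^ 3)) * (1 + Real.log (P.κφ * P.κx)) * (K + 1)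
            ≤ (5 + Real.log (1155 / (1 - 1 / c) ^ 3)) * (1 + Real.log (P.κφ * P.κx))
              * ((c + 2) * (√P.κφ * m + 1)) := by gcongr
          _ = _ := by rw [hA']; ring
      · exact le_mul_of_one_le_left hM hA1
  refine ⟨hit, hacc, fun ε hε => ?_, ?_⟩
  · obtain ⟨K, hK1, hK2⟩ := htotal ε hε
    refine ⟨K, hK1, hK2.trans ?_⟩
    gcongr
    linarith
  · set M := Real.log (1 + P.κx * P.σ ^ 2 * ‖x0 - P.xStar y0‖ ^ 2 / P.ε₁ c y0 ys ^ 2)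
    refine ⟨P.C c * P.gap y0 ys / Real.exp (max 1 M), by positivity, fun ε hε hε₀ => ?_⟩
    have hlog : max 1 M ≤ Real.log (P.C c * P.gap y0 ys / ε) := by
      rw [Real.le_log_iff_exp_le (by positivity), le_div_iff₀ hε]
      rw [lt_div_iff₀ (Real.exp_pos _)] at hε₀
      linarith
    obtain ⟨K, hK1, hK2⟩ := htotal ε hε
    refine ⟨K, hK1, hK2.trans ?_⟩
    have h1 : 1 ≤ Real.log (P.C c * P.gap y0 ys / ε) := (le_max_left _ _).trans hlog
    have h2 : M ≤ Real.log (P.C c * P.gap y0 ys / ε) := (le_max_right _ _).trans hlog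
    set ℓ := Real.log (P.C c * P.gap y0 ys / ε)
    set l := Real.log (P.κφ * P.κx)
    rw [max_eq_left (by linarith)]
    have h3 : ℓ ≤ √P.κφ * ℓ := le_mul_of_one_le_left (by linarith) hq
    have h4 : (1 + l) * (√P.κφ * ℓ + 1) + M ≤ 3 * ((1 + l) * (√P.κφ * ℓ)) := by
      nlinarith [mul_nonneg hl (by linarith : 0 ≤ √P.κφ * ℓ - 1)]
    have hκ0 : 0 ≤ P.κφ := by linarith [h.one_le_κφ]
    calc A' * √P.κx * ((1 + l) * (√P.κφ * ℓ + 1) + M)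
        ≤ A' * √P.κx * (3 * ((1 + l) * (√P.κφ * ℓ))) := by gcongr
      _ = 3 * A' * (1 + l) * (√(P.κφ * P.κx) * ℓ) := by rw [Real.sqrt_mul hκ0]; ring
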